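/- Let $1\le q\le n$ and $0\le\tilde q\le n$ be integers. For integers $m\ge 1$, $p\ge 0$ and $a>0$, let $W(m,p,a)$ (the complex Wishart distribution) be the law of $AA^*$, where $A$ is a random complex $m\times p$ matrix with density proportional to $e^{-a^{-1}\mathrm{Tr}(AA^*)}$ with respect to Lebesgue measure (for $p=0$ it is the Dirac mass at $0$). For $\alpha,\beta\ge 0$, the Jacobi unitary ensemble of parameter $(m,\alpha,\beta)$ is the probability measure on the Hermitian $m\times m$ matrices proportional to $$\det(1-M)^{\alpha}\det(M)^{\beta}\,1_{0\le M\le 1}\,dM ,$$ where $dM$ is Lebesgue measure. Let $X,X'\in M_q(\mathbb C)$ be independent random matrices with laws $W(q,\tilde q,1/q)$ and $W(q,n-\tilde q,1/q)$ respectively. Then $X+X'$ is almost surely positive definite, so that $$J=(X+X')^{-1/2}\,X\,(X+X')^{-1/2}$$ is almost surely well defined. Let $\pi\in M_n(\mathbb C)$ be a fixed orthogonal projection of rank $q$, and let $\tilde\pi\in M_n(\mathbb C)$ be a uniformly distributed random orthogonal projection of rank $\tilde q$, that is, $\tilde\pi$ has the law of $UpU^*$, where $U$ is a Haar distributed $n\times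 n$ unitary matrix and $p$ is a fixed orthogonal projection of rank $\tilde q$. Then there is an $n\times q$ matrix $V$ with $V^*V=1$ and $VV^*=\pi$, and for every such $V$, under the isomorphism $\pi M_n(\mathbb C)\pi\to M_q(\mathbb C)$, $A\mapsto V^*AV$, one has the equality in distribution $$\pi\tilde\pi\pi\overset{\mathcal L}{=}J .$$ In particular, if $q\le\tilde q$ and $q+\tilde q\le n$, then, under each of these isomorphisms, $\pi\tilde\pi\pi$ has the distribution of the Jacobi unitary ensemble of parameter $(q,\,n-q-\tilde q,\,\tilde q-q)$. -/

import Mathlib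

open MeasureTheory ProbabilityTheory
open scoped Matrix MatrixOrder ComplexOrder

noncomputable section

/-! ### Borel structures on matrices and on the unitary group -/

/-- Matrices carry the product σ-algebra, as functions of two indices. -/
instance matrixMeasurableSpace (m n : Type*) : MeasurableSpace (Matrix m n ℂ) :=
  inferInstanceAs (MeasurableSpace (m → n → ℂ))

instance matrixBorelSpace (m n : Type*) [Finite m] [Finite n] : BorelSpace (Matrix m n ℂ) :=
  inferInstanceAs (BorelSpace (m → n → ℂ))

theorem isCompact_unitaryGroup (n : ℕ) :
    IsCompact (Matrix.unitaryGroup (Fin n) ℂ : Set (Matrix (Fin n) (Fin n) ℂ)) := by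
  have hK : IsCompact (Set.pi Set.univ fun _ : Fin n => Set.pi Set.univ fun _ : Fin n =>
      Metric.closedBall (0 : ℂ) 1) :=
    isCompact_univ_pi fun _ => isCompact_univ_pi fun _ => isCompact_closedBall _ _
  refine IsCompact.of_isClosed_subset hK ?_ ?_
  · have h : (Matrix.unitaryGroup (Fin n) ℂ : Set (Matrix (Fin n) (Fin n) ℂ)) =
        {A | A * star A = 1} := by
      ext A
      exact Matrix.mem_unitaryGroup_iff
    rw [h]
    exact isClosed_eq (continuous_id.mul continuous_id.star) continuous_const
  · intro U hU i _ j _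
    simpa using entry_norm_bound_of_unitary hU i j

instance unitaryGroupCompactSpace (n : ℕ) : CompactSpace (Matrix.unitaryGroup (Fin n) ℂ) :=
  isCompact_iff_compactSpace.mp (isCompact_unitaryGroup n)

/-! ### Uniformly distributed projections -/

/-- The normalized Haar measure on the compact group of `n × n` complex unitary matrices. -/
def unitaryHaar (n : ℕ) : Measure (Matrix.unitaryGroup (Fin n) ℂ) :=
  Measure.haarMeasure ⊤

/-- The projection onto the span of the first `k` coordinate vectors of `ℂⁿ`. -/
def coordProjection (n k : ℕ) : Matrix (Fin n) (Fin n) ℂ :=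
  Matrix.diagonal fun i => if (i : ℕ) < k then 1 else 0

/-- The uniform distribution on the orthogonal projections of rank `k` in `M_n(ℂ)` (for `k ≤ n`):
the law of `U p U*`, where `U` is a Haar distributed unitary and `p` is a projection of rank `k`. -/
def uniformProjection (n k : ℕ) : Measure (Matrix (Fin n) (Fin n) ℂ) :=
  (unitaryHaar n).map fun U : Matrix.unitaryGroup (Fin n) ℂ =>
    (U : Matrix (Fin n) (Fin n) ℂ) * coordProjection n k * (U : Matrix (Fin n) (Fin n) ℂ)ᴴ

/-! ### Wishart and Jacobi ensembles -/

/-- The probability measure proportional to a measure of positive finite mass. -/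
def normalizedMeasure {S : Type*} [MeasurableSpace S] (μ : Measure S) : Measure S :=
  (μ Set.univ)⁻¹ • μ

/-- Lebesgue measure on complex `n × p` matrices. -/
def matrixLebesgue (n p : ℕ) : Measure (Matrix (Fin n) (Fin p) ℂ) :=
  (volume : Measure (Fin n → Fin p → ℂ))

/-- The probability measure on complex `n × p` matrices with density proportional to
`exp (- a⁻¹ Tr (A A*))`. -/
def gaussianMatrix (n p : ℕ) (a : ℝ) : Measure (Matrix (Fin n) (Fin p) ℂ) :=
  normalizedMeasure ((matrixLebesgue n p).withDensity fun A =>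
    ENNReal.ofReal (Real.exp (-(a⁻¹ * (A * Aᴴ).trace.re))))

/-- The complex Wishart distribution `W(n, p, a)`: the law of `A A*`, where `A` has density
proportional to `exp (- a⁻¹ Tr (A A*))` on complex `n × p` matrices. -/
def wishart (n p : ℕ) (a : ℝ) : Measure (Matrix (Fin n) (Fin n) ℂ) :=
  (gaussianMatrix n p a).map fun A => A * Aᴴ

/-- The Hermitian matrix with diagonal entries `x i i` and with entries
`x i j + √-1 * x j i` above the diagonal (`i < j`). -/
def hermitianOfCoords {n : ℕ} (x : Fin n → Fin n → ℝ) : Matrix (Fin n) (Fin n) ℂ :=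
  Matrix.of fun i j =>
    if i = j then (x i i : ℂ)
    else if i < j then (x i j : ℂ) + Complex.I * (x j i : ℂ)
    else (x j i : ℂ) - Complex.I * (x i j : ℂ)

/-- Lebesgue measure `dM = ∏ i, dM_ii ∏ i < j, d(Re M_ij) d(Im M_ij)` on the real vector space of
Hermitian `n × n` matrices, as a measure on all complex matrices carried by the Hermitian ones. -/
def hermitianLebesgue (n : ℕ) : Measure (Matrix (Fin n) (Fin n) ℂ) :=
  (volume : Measure (Fin n → Fin n → ℝ)).map hermitianOfCoords

open Classical in
/-- The Jacobi unitary ensemble of parameter `(n, α, β)`: the probability measure on Hermitian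
matrices proportional to `det (1 - M) ^ α * det M ^ β * 1_{0 ≤ M ≤ 1} dM`. -/
def jacobiUnitaryEnsemble (n : ℕ) (α β : ℝ) : Measure (Matrix (Fin n) (Fin n) ℂ) :=
  normalizedMeasure ((hermitianLebesgue n).withDensity fun M =>
    if M.PosSemidef ∧ (1 - M).PosSemidef then
      ENNReal.ofReal ((1 - M).det.re ^ α * M.det.re ^ β)
    else 0)

/-! ### The random matrix `J` and the compression to a corner -/

/-- `(X + X')^{-1/2} X (X + X')^{-1/2}`; for positive definite `X + X'`, the inverse of the
positive square root is the power `-1/2`. -/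
def jacobiTransform {q : ℕ} (X X' : Matrix (Fin q) (Fin q) ℂ) : Matrix (Fin q) (Fin q) ℂ :=
  (CFC.sqrt (X + X'))⁻¹ * X * (CFC.sqrt (X + X'))⁻¹

/-- `V` is an isometry `ℂ^q → ℂⁿ` with range projection `p`. Then `A ↦ Vᴴ * A * V` is a unitary
isomorphism of the corner `p M_n(ℂ) p` onto `M_q(ℂ)`, with inverse `B ↦ V * B * Vᴴ`. -/
def IsCornerIsometry {n q : ℕ} (p : Matrix (Fin n) (Fin n) ℂ) (V : Matrix (Fin n) (Fin q) ℂ) :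
    Prop :=
  Vᴴ * V = 1 ∧ V * Vᴴ = p

end

/-!
Write `n = r + s` with `s = n - r`.

*Equality in law.* If `A` and `B` are independent Gaussian matrices of sizes `q × r` and `q × s`,
then `G = [A | B]` has a density depending only on `G G* = A A* + B B*`, and for the coordinate
projection `E` of rank `r` one has `A A* = G E G*`. Hence `J = H E H*` with
`H = (G G*)^{-1/2} G`, which satisfies `H H* = 1` as soon as `G` has full rank, hence almost surely
(`ae_posDef_mul_conjTranspose`). Lebesgue measure is invariant under `G ↦ G U` for unitary `U`, so
`U` may be averaged over the unitary group. For fixed `G` the average is that of a function of the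
corner of `U E U*` cut out by the isometry `H*`, and by invariance of Haar measure it does not
depend on this isometry (`lintegral_unitaryHaar_corner`, `lintegral_polarCompression`). The same
average describes the corner of the uniform projection.

*Density.* For `q ≤ p` the image of Lebesgue measure on `q × p` matrices under `A ↦ A A*` is
proportional to `det X^{p-q} dX` (`exists_lintegral_mul_conjTranspose`). No Jacobian of this
nonlinear map is needed. The measures `det (A A*)^{-p} dA`, pushed to the positive definite cone,
and `det X^{-q} dX` are both invariant under all congruences `X ↦ T X T*`, and an averaging argument
over `GL_q(ℂ)` shows that such a measure is unique up to a factor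
(`lintegral_mul_eq_of_congruence_invariant`). The invariance rests on the determinants of the real
linear maps `A ↦ T A` and `X ↦ T X T*`, namely `|det T|^{2p}` and `|det T|^{2q}`. They are computed
by writing `T` as unitary times positive diagonal times unitary (`abs_det_of_mul`). Given the
densities of `X` and `X'`, the substitutions `S = X + X'` and `X = S^{1/2} M S^{1/2}` separate `S`
from `M`, and `M = J` has density proportional to `det M^{r-q} det (1-M)^{s-q}`
(`exists_lintegral_jacobiTransform`). All constants are determined at the end by total mass one.
-/

open MeasureTheory ProbabilityTheory
open scoped Matrix MatrixOrder ComplexOrder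

/-! ### Jacobians of the linear actions of `GL_q(ℂ)` -/

/-- A linear map that preserves a function `N` with bounded open sublevel set `{N < 1}` around `0`
preserves the volume of that set, hence has determinant `±1`. -/
theorem abs_det_eq_one_of_invariant {E : Type*} [NormedAddCommGroup E] [NormedSpace ℝ E]
    [FiniteDimensional ℝ E] (L : E →ₗ[ℝ] E) (N : E → ℝ) (hN : Continuous N) (hN0 : N 0 = 0)
    (hb : Bornology.IsBounded {x | N x < 1}) (hL : ∀ x, N (L x) = N x) :
    |LinearMap.det L| = 1 := by
  -- The line spanned by a vector of the kernel would lie in the bounded set `{N < 1}`.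
  have hinj : Function.Injective L := by
    rw [injective_iff_map_eq_zero]
    intro x hx
    by_contra hne
    obtain ⟨C, hC⟩ := hb.exists_norm_le
    have h1 : ∀ t : ℝ, ‖t • x‖ ≤ C := fun t => hC _ (by
      have := hL (t • x)
      rw [map_smul, hx, smul_zero, hN0] at this
      simp [← this])
    have h2 := h1 ((C + 1) / ‖x‖)
    have hx0 : 0 < ‖x‖ := norm_pos_iff.mpr hne
    have hC0 : 0 ≤ C := (norm_nonneg _).trans (h1 0)
    rw [norm_smul, Real.norm_of_nonneg (by positivity), div_mul_cancel₀ _ hx0.ne'] at h2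
    linarith
  have hdet : LinearMap.det L ≠ 0 := by
    intro h
    exact (LinearMap.bot_lt_ker_of_det_eq_zero h).ne' (LinearMap.ker_eq_bot.mpr hinj)
  borelize E
  let μ : Measure E := Measure.addHaar
  have hpre : L ⁻¹' {x | N x < 1} = {x | N x < 1} := by
    ext x
    simp [hL]
  have ho : IsOpen {x | N x < 1} := isOpen_lt hN continuous_const
  have hpos : μ {x | N x < 1} ≠ 0 := (ho.measure_pos μ ⟨0, by simp [hN0]⟩).ne'
  have hfin : μ {x | N x < 1} ≠ ⊤ := hb.measure_lt_top.ne
  have h := Measure.addHaar_preimage_linearMap μ hdet {x | N x < 1}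
  rw [hpre] at h
  have h' : ENNReal.ofReal |(LinearMap.det L)⁻¹| = 1 := by
    have h3 : 1 * μ {x | N x < 1} = ENNReal.ofReal |(LinearMap.det L)⁻¹| * μ {x | N x < 1} := by
      rw [one_mul]; exact h
    exact ((ENNReal.mul_left_inj hpos hfin).mp h3).symm
  rw [ENNReal.ofReal_eq_one, abs_inv, inv_eq_one] at h'
  exact h'

/-- Every invertible complex matrix is `W D U` with `W`, `U` unitary and `D` positive diagonal. -/
theorem exists_unitary_diagonal_unitary {q : ℕ} {T : Matrix (Fin q) (Fin q) ℂ}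
    (hT : IsUnit T.det) :
    ∃ W ∈ Matrix.unitaryGroup (Fin q) ℂ, ∃ U ∈ Matrix.unitaryGroup (Fin q) ℂ, ∃ d : Fin q → ℝ,
      (∀ i, 0 < d i) ∧ T = W * Matrix.diagonal (fun i => (d i : ℂ)) * U := by
  have hTu : IsUnit T := (Matrix.isUnit_iff_isUnit_det T).mpr hT
  have hpd : (T * Tᴴ).PosDef :=
    Matrix.PosDef.mul_conjTranspose_self T (Matrix.vecMul_injective_of_isUnit hTu)
  have hH := hpd.isHermitian
  set W := hH.eigenvectorUnitary with hW
  set d : Fin q → ℝ := fun i => √(hH.eigenvalues i) with hd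
  have hdpos : ∀ i, 0 < d i := fun i => Real.sqrt_pos.mpr (hpd.eigenvalues_pos i)
  have hspec := hH.spectral_theorem
  set D : Matrix (Fin q) (Fin q) ℂ := Matrix.diagonal (fun i => (d i : ℂ)) with hD
  set D' : Matrix (Fin q) (Fin q) ℂ := Matrix.diagonal (fun i => ((d i)⁻¹ : ℂ)) with hD'
  have hDD' : D * D' = 1 := by
    rw [hD, hD', Matrix.diagonal_mul_diagonal, ← Matrix.diagonal_one]
    congr 1; ext i
    exact mul_inv_cancel₀ (by exact_mod_cast (hdpos i).ne')
  have hD'h : D'ᴴ = D' := by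
    rw [hD', Matrix.diagonal_conjTranspose]; congr 1; ext i; simp
  have hWW : (W : Matrix (Fin q) (Fin q) ℂ)ᴴ * W = 1 := by
    rw [← Matrix.star_eq_conjTranspose]; exact Unitary.coe_star_mul_self W
  have hWW' : (W : Matrix (Fin q) (Fin q) ℂ) * (W : Matrix (Fin q) (Fin q) ℂ)ᴴ = 1 := by
    rw [← Matrix.star_eq_conjTranspose]; exact Unitary.coe_mul_star_self W
  -- With `T T* = W D² W*`, the remaining factor `D⁻¹ W* T` is unitary.
  have hX : T * Tᴴ = W * (D * D) * (W : Matrix (Fin q) (Fin q) ℂ)ᴴ := by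
    rw [hspec]
    simp only [Unitary.conjStarAlgAut_apply, Matrix.star_eq_conjTranspose, hD,
      Matrix.diagonal_mul_diagonal]
    congr 3; ext i
    simp only [Function.comp, hd]
    rw [← Complex.ofReal_mul, Real.mul_self_sqrt (hpd.eigenvalues_pos i).le]; simp
  refine ⟨W, W.2, D' * (W : Matrix (Fin q) (Fin q) ℂ)ᴴ * T, ?_, d, hdpos, ?_⟩
  · rw [Matrix.mem_unitaryGroup_iff, Matrix.star_eq_conjTranspose]
    have hD'D : D' * D = 1 := mul_eq_one_comm.mp hDD'
    calc D' * (W : Matrix (Fin q) (Fin q) ℂ)ᴴ * T * (D' * (W : Matrix (Fin q) (Fin q) ℂ)ᴴ * T)ᴴ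
        = D' * (W : Matrix (Fin q) (Fin q) ℂ)ᴴ * (T * Tᴴ) * W * D' := by
          simp only [Matrix.conjTranspose_mul, Matrix.conjTranspose_conjTranspose, hD'h,
            Matrix.mul_assoc]
      _ = D' * ((W : Matrix (Fin q) (Fin q) ℂ)ᴴ * W) * (D * D) *
            ((W : Matrix (Fin q) (Fin q) ℂ)ᴴ * W) * D' := by
          rw [hX]; simp only [Matrix.mul_assoc]
      _ = (D' * D) * (D * D') := by rw [hWW]; simp only [Matrix.mul_assoc, Matrix.mul_one]
      _ = 1 := by rw [hDD', hD'D, Matrix.one_mul]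
  · calc T = (W : Matrix (Fin q) (Fin q) ℂ) * (D * D') * (W : Matrix (Fin q) (Fin q) ℂ)ᴴ * T := by
          rw [hDD', Matrix.mul_one, hWW', Matrix.one_mul]
      _ = _ := by simp only [Matrix.mul_assoc, hD]

/-- The determinant character of a real representation of `GL_q(ℂ)` in which unitary matrices act
with determinant `±1` is determined by its values on positive diagonal matrices. -/
theorem abs_det_of_mul {q k : ℕ} {E : Type*} [AddCommGroup E] [Module ℝ E]
    (ρ : Matrix (Fin q) (Fin q) ℂ → E →ₗ[ℝ] E) (hmul : ∀ S T, ρ (S * T) = ρ S ∘ₗ ρ T)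
    (hU : ∀ U ∈ Matrix.unitaryGroup (Fin q) ℂ, |LinearMap.det (ρ U)| = 1)
    (hD : ∀ d : Fin q → ℝ, (∀ i, 0 < d i) →
      LinearMap.det (ρ (Matrix.diagonal fun i => (d i : ℂ))) = (∏ i, d i) ^ k)
    {T : Matrix (Fin q) (Fin q) ℂ} (hT : IsUnit T.det) :
    |LinearMap.det (ρ T)| = ‖T.det‖ ^ k := by
  obtain ⟨W, hW, U, hU', d, hd, rfl⟩ := exists_unitary_diagonal_unitary hT
  have hn : ∀ V ∈ Matrix.unitaryGroup (Fin q) ℂ, ‖V.det‖ = 1 := fun V hV => by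
    have := Matrix.det_of_mem_unitary hV
    exact CStarRing.norm_of_mem_unitary this
  have hdp : 0 ≤ ∏ i, d i := Finset.prod_nonneg fun i _ => (hd i).le
  rw [hmul, hmul, LinearMap.det_comp, LinearMap.det_comp, abs_mul, abs_mul, hU W hW, hU U hU',
    hD d hd, Matrix.det_mul, Matrix.det_mul, norm_mul, norm_mul, hn W hW, hn U hU',
    Matrix.det_diagonal, ← Complex.ofReal_prod, Complex.norm_real, Real.norm_of_nonneg hdp,
    abs_of_nonneg (pow_nonneg hdp k)]
  ring

/-! ### Lebesgue measure on rectangular matrices -/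

instance isAddHaarMeasure_volume_pi_pi (q p : ℕ) (K : Type*) [NormedAddCommGroup K]
    [InnerProductSpace ℝ K] [FiniteDimensional ℝ K] [MeasurableSpace K] [BorelSpace K] :
    (volume : Measure (Fin q → Fin p → K)).IsAddHaarMeasure :=
  Measure.pi.isAddHaarMeasure fun _ => volume

theorem lintegral_comp_linearMap {E : Type*} [NormedAddCommGroup E] [NormedSpace ℝ E]
    [FiniteDimensional ℝ E] [MeasurableSpace E] [BorelSpace E] (μ : Measure E)
    [μ.IsAddHaarMeasure] {L : E →ₗ[ℝ] E} (hL : LinearMap.det L ≠ 0) {f : E → ENNReal}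
    (hf : Measurable f) :
    ENNReal.ofReal |LinearMap.det L| * ∫⁻ x, f (L x) ∂μ = ∫⁻ x, f x ∂μ := by
  have hpos : 0 < |LinearMap.det L| := abs_pos.mpr hL
  rw [← lintegral_map hf L.continuous_of_finiteDimensional.measurable,
    Measure.map_linearMap_addHaar_eq_smul_addHaar μ hL, lintegral_smul_measure, abs_inv,
    ENNReal.ofReal_inv_of_pos hpos, smul_eq_mul, ← mul_assoc, ENNReal.mul_inv_cancel
    (by simpa using hpos) ENNReal.ofReal_ne_top, one_mul]

/-- Left multiplication by `T` on `q × p` matrices, as a real-linear map. -/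
def leftMulReal {q p : ℕ} (T : Matrix (Fin q) (Fin q) ℂ) :
    (Fin q → Fin p → ℂ) →ₗ[ℝ] (Fin q → Fin p → ℂ) where
  toFun A := T * Matrix.of A
  map_add' A B := Matrix.mul_add T (Matrix.of A) (Matrix.of B)
  map_smul' c A := Matrix.mul_smul T c (Matrix.of A)

/-- Right multiplication by `U` on `q × p` matrices, as a real-linear map. -/
def rightMulReal {q p : ℕ} (U : Matrix (Fin p) (Fin p) ℂ) :
    (Fin q → Fin p → ℂ) →ₗ[ℝ] (Fin q → Fin p → ℂ) where
  toFun A := Matrix.of A * U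
  map_add' A B := Matrix.add_mul (Matrix.of A) (Matrix.of B) U
  map_smul' c A := Matrix.smul_mul c (Matrix.of A) U

theorem trace_mul_conjTranspose_re {m n : Type*} [Fintype m] [Fintype n] (A : Matrix m n ℂ) :
    (A * Aᴴ).trace.re = ∑ i, ∑ j, ‖A i j‖ ^ 2 := by
  simp only [Matrix.trace, Matrix.diag_apply, Matrix.mul_apply, Matrix.conjTranspose_apply,
    Complex.re_sum]
  refine Finset.sum_congr rfl fun i _ => Finset.sum_congr rfl fun j _ => ?_
  rw [RCLike.star_def, Complex.mul_conj, Complex.normSq_eq_norm_sq, Complex.ofReal_re]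

theorem norm_entry_sq_le_trace {m n : Type*} [Fintype m] [Fintype n] (A : Matrix m n ℂ) (i : m)
    (j : n) : ‖A i j‖ ^ 2 ≤ (A * Aᴴ).trace.re := by
  rw [trace_mul_conjTranspose_re]
  exact (Finset.single_le_sum (f := fun j => ‖A i j‖ ^ 2) (fun _ _ => by positivity)
    (Finset.mem_univ j)).trans
    (Finset.single_le_sum (f := fun i => ∑ j, ‖A i j‖ ^ 2) (fun _ _ => by positivity)
    (Finset.mem_univ i))

/-- A real-linear map of matrices that preserves `Tr(AA*)` has determinant `±1`. -/
theorem abs_det_eq_one_of_trace {q p : ℕ} (L : (Fin q → Fin p → ℂ) →ₗ[ℝ] (Fin q → Fin p → ℂ))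
    (hL : ∀ A, (Matrix.of (L A) * (Matrix.of (L A))ᴴ).trace =
      (Matrix.of A * (Matrix.of A)ᴴ).trace) :
    |LinearMap.det L| = 1 := by
  refine abs_det_eq_one_of_invariant L (fun A => (Matrix.of A * (Matrix.of A)ᴴ).trace.re) ?_ ?_ ?_
    (fun A => by rw [hL])
  · simp only [trace_mul_conjTranspose_re]
    simp only [Matrix.of_apply]
    fun_prop
  · simp only [trace_mul_conjTranspose_re]
    simp
  · refine (Metric.isBounded_closedBall (x := (0 : Fin q → Fin p → ℂ)) (r := 1)).subset ?_
    intro A hA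
    rw [mem_closedBall_zero_iff, pi_norm_le_iff_of_nonneg zero_le_one]
    intro i
    rw [pi_norm_le_iff_of_nonneg zero_le_one]
    intro j
    have h := (norm_entry_sq_le_trace (Matrix.of A) i j).trans_lt hA
    exact (sq_le_one_iff₀ (norm_nonneg _)).mp h.le

theorem abs_det_leftMulReal {q p : ℕ} {T : Matrix (Fin q) (Fin q) ℂ} (hT : IsUnit T.det) :
    |LinearMap.det (leftMulReal (p := p) T)| = ‖T.det‖ ^ (2 * p) := by
  refine abs_det_of_mul (fun T => leftMulReal (p := p) T) ?_ ?_ ?_ hT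
  · intro S T
    refine LinearMap.ext fun A => ?_
    exact Matrix.mul_assoc S T (Matrix.of A)
  · intro U hU
    refine abs_det_eq_one_of_trace _ fun A => ?_
    change ((U * Matrix.of A) * (U * Matrix.of A)ᴴ).trace = _
    rw [Matrix.conjTranspose_mul, Matrix.trace_mul_comm, Matrix.mul_assoc, ← Matrix.mul_assoc Uᴴ,
      ← Matrix.star_eq_conjTranspose U, Matrix.mem_unitaryGroup_iff'.mp hU, Matrix.one_mul,
      Matrix.trace_mul_comm]
  · intro d hd
    have : leftMulReal (p := p) (Matrix.diagonal fun i => (d i : ℂ)) =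
        LinearMap.pi fun i => ((d i) • (LinearMap.id : (Fin p → ℂ) →ₗ[ℝ] (Fin p → ℂ))) ∘ₗ
          LinearMap.proj i := by
      refine LinearMap.ext fun A => ?_
      funext i j
      change (Matrix.diagonal (fun i => (d i : ℂ)) * Matrix.of A) i j = d i • A i j
      rw [Matrix.diagonal_mul]
      simp
    rw [this, LinearMap.det_pi]
    simp only [LinearMap.det_smul, LinearMap.det_id, mul_one]
    rw [Finset.prod_pow]
    congr 1
    simp [Module.finrank_pi_fintype]
    ring

theorem lintegral_matrixLebesgue_mul {q p : ℕ} {T : Matrix (Fin q) (Fin q) ℂ} (hT : IsUnit T.det)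
    {f : Matrix (Fin q) (Fin p) ℂ → ENNReal} (hf : Measurable f) :
    ENNReal.ofReal (‖T.det‖ ^ (2 * p)) * ∫⁻ A, f (T * A) ∂(matrixLebesgue q p) =
      ∫⁻ A, f A ∂(matrixLebesgue q p) := by
  have hpos : 0 < ‖T.det‖ ^ (2 * p) := pow_pos (norm_pos_iff.mpr hT.ne_zero) _
  have hdet : LinearMap.det (leftMulReal (p := p) T) ≠ 0 := by
    rw [← abs_pos, abs_det_leftMulReal hT]; exact hpos
  rw [← abs_det_leftMulReal (p := p) hT]
  exact lintegral_comp_linearMap (volume : Measure (Fin q → Fin p → ℂ)) hdet hf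

theorem lintegral_matrixLebesgue_mul_unitary {q p : ℕ} {U : Matrix (Fin p) (Fin p) ℂ}
    (hU : U ∈ Matrix.unitaryGroup (Fin p) ℂ)
    {f : Matrix (Fin q) (Fin p) ℂ → ENNReal} (hf : Measurable f) :
    ∫⁻ A, f (A * U) ∂(matrixLebesgue q p) = ∫⁻ A, f A ∂(matrixLebesgue q p) := by
  have habs : |LinearMap.det (rightMulReal (q := q) U)| = 1 := by
    refine abs_det_eq_one_of_trace _ fun A => ?_
    change ((Matrix.of A * U) * (Matrix.of A * U)ᴴ).trace = _
    rw [Matrix.conjTranspose_mul, Matrix.mul_assoc, ← Matrix.mul_assoc U,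
      ← Matrix.star_eq_conjTranspose U, Matrix.mem_unitaryGroup_iff.mp hU, Matrix.one_mul]
  have hdet : LinearMap.det (rightMulReal (q := q) U) ≠ 0 := by
    rw [← abs_pos, habs]; exact one_pos
  have h := lintegral_comp_linearMap (volume : Measure (Fin q → Fin p → ℂ)) hdet (f := f) hf
  rw [habs, ENNReal.ofReal_one, one_mul] at h
  exact h

/-! ### Lebesgue measure on Hermitian matrices -/

/-- The coordinates of a Hermitian matrix, inverse to `hermitianOfCoords`. -/
def hermitianCoords {q : ℕ} (M : Matrix (Fin q) (Fin q) ℂ) : Fin q → Fin q → ℝ :=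
  fun i j => if i ≤ j then (M i j).re else (M j i).im

theorem hermitianCoords_hermitianOfCoords {q : ℕ} (x : Fin q → Fin q → ℝ) :
    hermitianCoords (hermitianOfCoords x) = x := by
  funext i j
  rcases lt_trichotomy i j with h | rfl | h
  · simp [hermitianCoords, hermitianOfCoords, h, h.le, h.ne]
  · simp [hermitianCoords, hermitianOfCoords]
  · simp [hermitianCoords, hermitianOfCoords, h, h.not_ge, h.ne]

theorem isHermitian_hermitianOfCoords {q : ℕ} (x : Fin q → Fin q → ℝ) :
    (hermitianOfCoords x).IsHermitian := by
  ext i j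
  rcases lt_trichotomy i j with h | rfl | h
  · simp [Matrix.conjTranspose_apply, hermitianOfCoords, h, h.not_gt, h.ne, h.ne', sub_eq_add_neg]
  · simp [Matrix.conjTranspose_apply, hermitianOfCoords]
  · simp [Matrix.conjTranspose_apply, hermitianOfCoords, h, h.not_gt, h.ne, h.ne', sub_eq_add_neg]

theorem hermitianOfCoords_hermitianCoords {q : ℕ} {M : Matrix (Fin q) (Fin q) ℂ}
    (hM : M.IsHermitian) : hermitianOfCoords (hermitianCoords M) = M := by
  ext i j
  have hij := hM.apply i j
  rcases lt_trichotomy i j with h | rfl | h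
  · simp [hermitianCoords, hermitianOfCoords, h, h.le, h.not_ge, h.ne]
    apply Complex.ext <;> simp
  · simp only [hermitianCoords, hermitianOfCoords, Matrix.of_apply, if_true, le_refl]
    exact Complex.conj_eq_iff_re.mp hij
  · simp only [hermitianCoords, hermitianOfCoords, Matrix.of_apply, h.not_gt, h.ne', h.le, h.not_ge,
      if_true, if_false]
    rw [← hij, RCLike.star_def]
    apply Complex.ext <;> simp

theorem hermitianOfCoords_add {q : ℕ} (x y : Fin q → Fin q → ℝ) :
    hermitianOfCoords (x + y) = hermitianOfCoords x + hermitianOfCoords y := by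
  ext i j
  simp only [hermitianOfCoords, Matrix.of_apply, Matrix.add_apply, Pi.add_apply]
  split_ifs <;> push_cast <;> ring

theorem hermitianOfCoords_smul {q : ℕ} (c : ℝ) (x : Fin q → Fin q → ℝ) :
    hermitianOfCoords (c • x) = (c : ℂ) • hermitianOfCoords x := by
  ext i j
  simp only [hermitianOfCoords, Matrix.of_apply, Matrix.smul_apply, Pi.smul_apply, smul_eq_mul]
  split_ifs <;> push_cast <;> ring

theorem continuous_hermitianOfCoords {q : ℕ} :
    Continuous (hermitianOfCoords : (Fin q → Fin q → ℝ) → Matrix (Fin q) (Fin q) ℂ) := by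
  refine continuous_matrix fun i j => ?_
  simp only [hermitianOfCoords, Matrix.of_apply]
  split_ifs <;> fun_prop

theorem hermitianCoords_add {q : ℕ} (M N : Matrix (Fin q) (Fin q) ℂ) :
    hermitianCoords (M + N) = hermitianCoords M + hermitianCoords N := by
  funext i j
  simp only [hermitianCoords, Matrix.add_apply, Pi.add_apply]
  split_ifs <;> simp

theorem hermitianCoords_smul {q : ℕ} (c : ℝ) (M : Matrix (Fin q) (Fin q) ℂ) :
    hermitianCoords ((c : ℂ) • M) = c • hermitianCoords M := by
  funext i j
  simp only [hermitianCoords, Matrix.smul_apply, Pi.smul_apply, smul_eq_mul]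
  split_ifs <;> simp

/-- The congruence `X ↦ T X T*` of Hermitian matrices, in coordinates. -/
def congruenceReal {q : ℕ} (T : Matrix (Fin q) (Fin q) ℂ) :
    (Fin q → Fin q → ℝ) →ₗ[ℝ] (Fin q → Fin q → ℝ) where
  toFun x := hermitianCoords (T * hermitianOfCoords x * Tᴴ)
  map_add' x y := by
    rw [hermitianOfCoords_add, Matrix.mul_add, Matrix.add_mul, hermitianCoords_add]
  map_smul' c x := by
    rw [hermitianOfCoords_smul, Matrix.mul_smul, Matrix.smul_mul, hermitianCoords_smul]
    rfl

theorem hermitianOfCoords_congruenceReal {q : ℕ} (T : Matrix (Fin q) (Fin q) ℂ)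
    (x : Fin q → Fin q → ℝ) :
    hermitianOfCoords (congruenceReal T x) = T * hermitianOfCoords x * Tᴴ :=
  hermitianOfCoords_hermitianCoords
    (Matrix.isHermitian_mul_mul_conjTranspose T (isHermitian_hermitianOfCoords x))

theorem abs_hermitianCoords_le {q : ℕ} (M : Matrix (Fin q) (Fin q) ℂ) {C : ℝ}
    (hM : ∀ i j, ‖M i j‖ ≤ C) (i j : Fin q) : |hermitianCoords M i j| ≤ C := by
  simp only [hermitianCoords]
  split_ifs
  · exact (Complex.abs_re_le_norm _).trans (hM _ _)
  · exact (Complex.abs_im_le_norm _).trans (hM _ _)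

theorem abs_det_congruenceReal {q : ℕ} {T : Matrix (Fin q) (Fin q) ℂ} (hT : IsUnit T.det) :
    |LinearMap.det (congruenceReal T)| = ‖T.det‖ ^ (2 * q) := by
  refine abs_det_of_mul congruenceReal ?_ ?_ ?_ hT
  · intro S T
    refine LinearMap.ext fun x => ?_
    change hermitianCoords (S * T * hermitianOfCoords x * (S * T)ᴴ) =
      hermitianCoords (S * hermitianOfCoords (congruenceReal T x) * Sᴴ)
    rw [hermitianOfCoords_congruenceReal, Matrix.conjTranspose_mul]
    simp only [Matrix.mul_assoc]
  · intro U hU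
    refine abs_det_eq_one_of_invariant _
      (fun x => (hermitianOfCoords x * (hermitianOfCoords x)ᴴ).trace.re) ?_ ?_ ?_ ?_
    · have := continuous_hermitianOfCoords (q := q)
      exact Complex.continuous_re.comp
        (Continuous.matrix_trace (this.matrix_mul this.matrix_conjTranspose))
    · have : hermitianOfCoords (0 : Fin q → Fin q → ℝ) = 0 := by
        simpa using hermitianOfCoords_smul (0 : ℝ) (0 : Fin q → Fin q → ℝ)
      simp [this]
    · refine (Metric.isBounded_closedBall (x := (0 : Fin q → Fin q → ℝ)) (r := 1)).subset ?_
      intro x hx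
      rw [mem_closedBall_zero_iff, pi_norm_le_iff_of_nonneg zero_le_one]
      intro i
      rw [pi_norm_le_iff_of_nonneg zero_le_one]
      intro j
      rw [← hermitianCoords_hermitianOfCoords x]
      refine abs_hermitianCoords_le _ (fun i j => ?_) i j
      have h := (norm_entry_sq_le_trace (hermitianOfCoords x) i j).trans_lt hx
      exact (sq_le_one_iff₀ (norm_nonneg _)).mp h.le
    · intro x
      have hUU : Uᴴ * U = 1 := Matrix.mem_unitaryGroup_iff'.mp hU
      rw [hermitianOfCoords_congruenceReal]
      set X := hermitianOfCoords x
      have : U * X * Uᴴ * (U * X * Uᴴ)ᴴ = U * (X * (Uᴴ * U) * Xᴴ * Uᴴ) := by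
        simp only [Matrix.conjTranspose_mul, Matrix.conjTranspose_conjTranspose, Matrix.mul_assoc]
      rw [this, hUU, Matrix.mul_one, Matrix.trace_mul_comm, Matrix.mul_assoc, hUU, Matrix.mul_one]
  · intro d hd
    have : congruenceReal (Matrix.diagonal fun i => (d i : ℂ)) =
        LinearMap.pi fun i => (LinearMap.pi fun j =>
          ((d i * d j) • (LinearMap.id : ℝ →ₗ[ℝ] ℝ)) ∘ₗ LinearMap.proj j) ∘ₗ
          LinearMap.proj i := by
      refine LinearMap.ext fun x => ?_
      funext i j
      change hermitianCoords (Matrix.diagonal (fun i => (d i : ℂ)) * hermitianOfCoords x *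
        (Matrix.diagonal (fun i => (d i : ℂ)))ᴴ) i j = (d i * d j) • x i j
      conv_rhs => rw [← hermitianCoords_hermitianOfCoords x]
      simp only [hermitianCoords, Matrix.diagonal_conjTranspose, Matrix.mul_diagonal,
        Matrix.diagonal_mul, smul_eq_mul, Pi.star_apply, RCLike.star_def, Complex.conj_ofReal]
      split_ifs
      · rw [mul_right_comm, ← Complex.ofReal_mul, Complex.re_ofReal_mul]
      · rw [mul_right_comm, ← Complex.ofReal_mul, Complex.im_ofReal_mul, mul_comm (d j)]
    rw [this, LinearMap.det_pi]
    simp only [LinearMap.det_pi, LinearMap.det_smul, LinearMap.det_id, mul_one,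
      Module.finrank_self, pow_one, Finset.prod_mul_distrib, Finset.prod_const, Finset.card_univ,
      Fintype.card_fin, Finset.prod_pow]
    ring

theorem measurable_hermitianOfCoords {q : ℕ} :
    Measurable (hermitianOfCoords : (Fin q → Fin q → ℝ) → Matrix (Fin q) (Fin q) ℂ) :=
  continuous_hermitianOfCoords.measurable

theorem lintegral_hermitianLebesgue {q : ℕ} {f : Matrix (Fin q) (Fin q) ℂ → ENNReal}
    (hf : Measurable f) :
    ∫⁻ X, f X ∂(hermitianLebesgue q) = ∫⁻ x : Fin q → Fin q → ℝ, f (hermitianOfCoords x) :=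
  lintegral_map hf measurable_hermitianOfCoords

theorem lintegral_hermitianLebesgue_congruence {q : ℕ} {T : Matrix (Fin q) (Fin q) ℂ}
    (hT : IsUnit T.det) {f : Matrix (Fin q) (Fin q) ℂ → ENNReal} (hf : Measurable f) :
    ENNReal.ofReal (‖T.det‖ ^ (2 * q)) * ∫⁻ X, f (T * X * Tᴴ) ∂(hermitianLebesgue q) =
      ∫⁻ X, f X ∂(hermitianLebesgue q) := by
  have hpos : 0 < ‖T.det‖ ^ (2 * q) := pow_pos (norm_pos_iff.mpr hT.ne_zero) _
  have hdet : LinearMap.det (congruenceReal T) ≠ 0 := by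
    rw [← abs_pos, abs_det_congruenceReal hT]; exact hpos
  have hc : Continuous fun X : Matrix (Fin q) (Fin q) ℂ => T * X * Tᴴ := by fun_prop
  rw [lintegral_hermitianLebesgue (f := fun X => f (T * X * Tᴴ)) (hf.comp hc.measurable),
    lintegral_hermitianLebesgue hf, ← abs_det_congruenceReal hT,
    ← lintegral_comp_linearMap (volume : Measure (Fin q → Fin q → ℝ)) hdet
      (f := fun x => f (hermitianOfCoords x)) (hf.comp measurable_hermitianOfCoords)]
  simp only [hermitianOfCoords_congruenceReal]

theorem lintegral_hermitianLebesgue_sub {q : ℕ} {X : Matrix (Fin q) (Fin q) ℂ}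
    (hX : X.IsHermitian) {f : Matrix (Fin q) (Fin q) ℂ → ENNReal} (hf : Measurable f) :
    ∫⁻ S, f (S - X) ∂(hermitianLebesgue q) = ∫⁻ S, f S ∂(hermitianLebesgue q) := by
  have hc : Continuous fun S : Matrix (Fin q) (Fin q) ℂ => S - X := by fun_prop
  rw [lintegral_hermitianLebesgue (f := fun S => f (S - X)) (hf.comp hc.measurable),
    lintegral_hermitianLebesgue hf]
  have : ∀ x, hermitianOfCoords x - X = hermitianOfCoords (x - hermitianCoords X) := fun x => by
    rw [sub_eq_iff_eq_add, ← hermitianOfCoords_hermitianCoords hX, ← hermitianOfCoords_add,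
      hermitianCoords_hermitianOfCoords, sub_add_cancel]
  simp only [this]
  exact lintegral_sub_right_eq_self (fun x => f (hermitianOfCoords x)) (hermitianCoords X)

/-! ### Measurability -/

instance matrixSecondCountable (m n : Type*) [Finite m] [Finite n] :
    SecondCountableTopology (Matrix m n ℂ) :=
  inferInstanceAs (SecondCountableTopology (m → n → ℂ))

theorem isClosed_posSemidef (q : ℕ) : IsClosed {X : Matrix (Fin q) (Fin q) ℂ | X.PosSemidef} := by
  have h : {X : Matrix (Fin q) (Fin q) ℂ | X.PosSemidef} =
      {X | Xᴴ = X} ∩ ⋂ v : Fin q → ℂ, {X | 0 ≤ star v ⬝ᵥ (X *ᵥ v)} := by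
    ext X
    simp [Matrix.posSemidef_iff_dotProduct_mulVec, Matrix.IsHermitian]
  rw [h]
  refine (isClosed_eq (by fun_prop) continuous_id).inter (isClosed_iInter fun v => ?_)
  exact isClosed_le continuous_const (by fun_prop)

theorem measurableSet_posSemidef (q : ℕ) :
    MeasurableSet {X : Matrix (Fin q) (Fin q) ℂ | X.PosSemidef} :=
  (isClosed_posSemidef q).measurableSet

theorem measurable_det {q : ℕ} : Measurable (Matrix.det : Matrix (Fin q) (Fin q) ℂ → ℂ) :=
  (continuous_id.matrix_det).measurable

theorem measurableSet_posDef (q : ℕ) :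
    MeasurableSet {X : Matrix (Fin q) (Fin q) ℂ | X.PosDef} := by
  have h : {X : Matrix (Fin q) (Fin q) ℂ | X.PosDef} =
      {X | X.PosSemidef} ∩ {X | X.det ≠ 0} := by
    ext X
    refine ⟨fun h => ⟨h.posSemidef, h.posSemidef.posDef_iff_det_ne_zero.mp h⟩,
      fun h => h.1.posDef_iff_det_ne_zero.mpr h.2⟩
  rw [h]
  exact (measurableSet_posSemidef q).inter
    (measurable_det (MeasurableSet.singleton (0 : ℂ)).compl)

theorem measurable_matrix_inv {q : ℕ} :
    Measurable fun X : Matrix (Fin q) (Fin q) ℂ => X⁻¹ := by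
  have hadj : Measurable fun X : Matrix (Fin q) (Fin q) ℂ => X.adjugate :=
    (continuous_id.matrix_adjugate).measurable
  refine measurable_pi_iff.mpr fun i => measurable_pi_iff.mpr fun j => ?_
  have : (fun X : Matrix (Fin q) (Fin q) ℂ => X⁻¹ i j) =
      fun X => (X.det)⁻¹ * X.adjugate i j := by
    funext X
    simp [Matrix.inv_def, Ring.inverse_eq_inv]
  rw [this]
  exact measurable_det.inv.mul
    ((measurable_pi_apply j).comp ((measurable_pi_apply i).comp hadj))

open scoped Matrix.Norms.L2Operator in
theorem continuousOn_matrix_sqrt (q : ℕ) :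
    ContinuousOn (CFC.sqrt : Matrix (Fin q) (Fin q) ℂ → Matrix (Fin q) (Fin q) ℂ) {X | 0 ≤ X} :=
  CFC.continuousOn_sqrt

theorem measurable_matrix_sqrt {q : ℕ} :
    Measurable (CFC.sqrt : Matrix (Fin q) (Fin q) ℂ → Matrix (Fin q) (Fin q) ℂ) := by
  classical
  have hm : MeasurableSet {X : Matrix (Fin q) (Fin q) ℂ | 0 ≤ X} := by
    simpa only [Matrix.nonneg_iff_posSemidef] using measurableSet_posSemidef q
  have h := (continuousOn_matrix_sqrt q).measurable_piecewise (g := fun _ => 0)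
    (continuousOn_const (c := (0 : Matrix (Fin q) (Fin q) ℂ))) hm
  convert h using 1
  funext X
  by_cases hX : 0 ≤ X
  · simp [Set.piecewise, hX]
  · simp [Set.piecewise, hX, CFC.sqrt_of_not_nonneg]

theorem Measurable.jacobiTransform {α : Type*} [MeasurableSpace α] {q : ℕ}
    {f g : α → Matrix (Fin q) (Fin q) ℂ} (hf : Measurable f) (hg : Measurable g) :
    Measurable fun x => jacobiTransform (f x) (g x) := by
  have h : Measurable fun x => (CFC.sqrt (f x + g x))⁻¹ :=
    measurable_matrix_inv.comp (measurable_matrix_sqrt.comp (hf.add hg))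
  exact (h.mul hf).mul h

theorem AEMeasurable.jacobiTransform {α : Type*} [MeasurableSpace α] {μ : Measure α} {q : ℕ}
    {f g : α → Matrix (Fin q) (Fin q) ℂ} (hf : AEMeasurable f μ) (hg : AEMeasurable g μ) :
    AEMeasurable (fun x => jacobiTransform (f x) (g x)) μ := by
  refine ⟨_, hf.measurable_mk.jacobiTransform hg.measurable_mk, ?_⟩
  filter_upwards [hf.ae_eq_mk, hg.ae_eq_mk] with x h1 h2
  rw [h1, h2]

theorem measurable_mul_conjTranspose {q p : ℕ} :
    Measurable fun A : Matrix (Fin q) (Fin p) ℂ => A * Aᴴ :=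
  (continuous_id.matrix_mul continuous_id.matrix_conjTranspose).measurable

/-! ### Null sets of singular matrices -/

theorem ae_det_add_smul_one_ne_zero {q : ℕ} (M : Matrix (Fin q) (Fin q) ℂ) :
    ∀ᵐ t : ℝ, (M + (t : ℂ) • (1 : Matrix (Fin q) (Fin q) ℂ)).det ≠ 0 := by
  have hfin : {z : ℂ | (-M).charpoly.IsRoot z}.Finite :=
    Polynomial.finite_setOfPred_isRoot (Matrix.charpoly_monic (-M)).ne_zero
  have hfin' : {t : ℝ | (M + (t : ℂ) • (1 : Matrix (Fin q) (Fin q) ℂ)).det = 0}.Finite := by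
    refine (hfin.preimage (f := fun t : ℝ => (t : ℂ))
      (Complex.ofReal_injective.injOn)).subset fun t ht => ?_
    simp only [Set.mem_preimage, Set.mem_ofPred_eq, Polynomial.IsRoot, Matrix.eval_charpoly]
    rw [← ht]
    congr 1
    rw [sub_neg_eq_add, add_comm, Matrix.smul_one_eq_diagonal]
    rfl
  rw [ae_iff]
  simpa using hfin'.measure_zero volume

/-- Perturbing `A` along a fixed coisometry `K` makes `(A + t K) K* = A K* + t` invertible for
almost every `t`. -/
theorem ae_posDef_mul_conjTranspose {q p : ℕ} (hqp : q ≤ p) :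
    ∀ᵐ A ∂(matrixLebesgue q p), (A * Aᴴ).PosDef := by
  let K : Matrix (Fin q) (Fin p) ℂ := Matrix.of fun i j => if j = Fin.castLE hqp i then 1 else 0
  have hK : K * Kᴴ = 1 := by
    ext i j
    simp [K, Matrix.mul_apply, Matrix.one_apply, Fin.castLE_inj, eq_comm]
  have hs : MeasurableSet {A : Fin q → Fin p → ℂ | (Matrix.of A * (Matrix.of A)ᴴ).PosDef} :=
    measurable_mul_conjTranspose (measurableSet_posDef q)
  refine ae_mem_of_ae_add_linearMap_mem (LinearMap.toSpanSingleton ℝ (Fin q → Fin p → ℂ) K)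
    (volume : Measure ℝ) (volume : Measure (Fin q → Fin p → ℂ)) hs fun A => ?_
  filter_upwards [ae_det_add_smul_one_ne_zero (Matrix.of A * Kᴴ)] with t ht
  set B : Matrix (Fin q) (Fin p) ℂ := Matrix.of A + (t : ℂ) • K with hB
  have hBt : (A + LinearMap.toSpanSingleton ℝ (Fin q → Fin p → ℂ) K t) = B := by
    funext i j
    change A i j + t • K i j = A i j + (t : ℂ) * K i j
    rw [Complex.real_smul]
  change ((Matrix.of (A + LinearMap.toSpanSingleton ℝ (Fin q → Fin p → ℂ) K t)) *
    (Matrix.of (A + LinearMap.toSpanSingleton ℝ (Fin q → Fin p → ℂ) K t))ᴴ).PosDef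
  rw [hBt]
  have hBK : B * Kᴴ = Matrix.of A * Kᴴ + (t : ℂ) • (1 : Matrix (Fin q) (Fin q) ℂ) := by
    rw [hB, Matrix.add_mul, Matrix.smul_mul, hK]
  have hu : IsUnit (B * Kᴴ) := by
    rw [Matrix.isUnit_iff_isUnit_det, hBK]
    exact ht.isUnit
  refine Matrix.PosDef.mul_conjTranspose_self B fun v w hvw => ?_
  refine Matrix.vecMul_injective_of_isUnit hu ?_
  have := congrArg (fun u => u ᵥ* Kᴴ) hvw
  simpa [Matrix.vecMul_vecMul] using this

theorem ae_det_ne_zero_matrixLebesgue (q : ℕ) :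
    ∀ᵐ A ∂(matrixLebesgue q q), IsUnit A.det := by
  filter_upwards [ae_posDef_mul_conjTranspose (le_refl q)] with A hA
  have := (Matrix.isUnit_iff_isUnit_det _).mp hA.isUnit
  rw [Matrix.det_mul] at this
  exact isUnit_of_mul_isUnit_left this

theorem ae_isHermitian_hermitianLebesgue (q : ℕ) :
    ∀ᵐ X ∂(hermitianLebesgue q), X.IsHermitian := by
  have hs : MeasurableSet {X : Matrix (Fin q) (Fin q) ℂ | X.IsHermitian} :=
    (isClosed_eq (f := fun X : Matrix (Fin q) (Fin q) ℂ => Xᴴ) (by fun_prop)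
      continuous_id).measurableSet
  rw [hermitianLebesgue, ae_map_iff measurable_hermitianOfCoords.aemeasurable hs]
  exact Filter.Eventually.of_forall isHermitian_hermitianOfCoords

theorem ae_det_ne_zero_hermitianLebesgue (q : ℕ) :
    ∀ᵐ X ∂(hermitianLebesgue q), X.det ≠ 0 := by
  have hs : MeasurableSet {X : Matrix (Fin q) (Fin q) ℂ | X.det ≠ 0} :=
    measurable_det (MeasurableSet.singleton (0 : ℂ)).compl
  rw [hermitianLebesgue, ae_map_iff measurable_hermitianOfCoords.aemeasurable hs]
  refine ae_mem_of_ae_add_linearMap_mem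
    (LinearMap.toSpanSingleton ℝ (Fin q → Fin q → ℝ) (hermitianCoords 1))
    (volume : Measure ℝ) (volume : Measure (Fin q → Fin q → ℝ))
    (measurable_hermitianOfCoords hs) fun x => ?_
  filter_upwards [ae_det_add_smul_one_ne_zero (hermitianOfCoords x)] with t ht
  change (hermitianOfCoords (x + t • hermitianCoords 1)).det ≠ 0
  rwa [hermitianOfCoords_add, hermitianOfCoords_smul,
    hermitianOfCoords_hermitianCoords Matrix.isHermitian_one]

/-! ### Invariant measures on the cone of positive definite matrices -/

theorem det_conj_mul_mul_re {q : ℕ} (T X : Matrix (Fin q) (Fin q) ℂ) :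
    (T * X * Tᴴ).det.re = ‖T.det‖ ^ 2 * X.det.re := by
  rw [Matrix.det_mul, Matrix.det_mul, Matrix.det_conjTranspose, mul_right_comm, RCLike.star_def,
    Complex.mul_conj, Complex.normSq_eq_norm_sq, Complex.re_ofReal_mul]

theorem Matrix.PosDef.det_re_pos {q : ℕ} {X : Matrix (Fin q) (Fin q) ℂ} (hX : X.PosDef) :
    0 < X.det.re :=
  (Complex.pos_iff.mp hX.det_pos).1

/-- The measure `|det T|^{-2q} dT` on `q × q` matrices: the Haar measure of `GL_q(ℂ)`. -/
noncomputable def generalLinearHaar (q : ℕ) : Measure (Matrix (Fin q) (Fin q) ℂ) :=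
  (matrixLebesgue q q).withDensity fun T => ENNReal.ofReal ((‖T.det‖ ^ (2 * q))⁻¹)

theorem measurable_generalLinearHaar_density (q : ℕ) :
    Measurable fun T : Matrix (Fin q) (Fin q) ℂ => ENNReal.ofReal ((‖T.det‖ ^ (2 * q))⁻¹) :=
  ((measurable_det.norm.pow_const _).inv).ennreal_ofReal

instance matrixLebesgue_sigmaFinite (q p : ℕ) : SigmaFinite (matrixLebesgue q p) :=
  inferInstanceAs (SigmaFinite (volume : Measure (Fin q → Fin p → ℂ)))

instance generalLinearHaar_sFinite (q : ℕ) : SFinite (generalLinearHaar q) := by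
  unfold generalLinearHaar; infer_instance

instance hermitianLebesgue_sFinite (q : ℕ) : SFinite (hermitianLebesgue q) := by
  unfold hermitianLebesgue; infer_instance

theorem ae_isUnit_det_generalLinearHaar (q : ℕ) :
    ∀ᵐ T ∂(generalLinearHaar q), IsUnit T.det :=
  (withDensity_absolutelyContinuous _ _).ae_le (ae_det_ne_zero_matrixLebesgue q)

theorem lintegral_generalLinearHaar_mul {q : ℕ} {S : Matrix (Fin q) (Fin q) ℂ}
    (hS : IsUnit S.det) {f : Matrix (Fin q) (Fin q) ℂ → ENNReal} (hf : Measurable f) :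
    ∫⁻ T, f (S * T) ∂(generalLinearHaar q) = ∫⁻ T, f T ∂(generalLinearHaar q) := by
  have hw := measurable_generalLinearHaar_density q
  have hc : Measurable fun T : Matrix (Fin q) (Fin q) ℂ => S * T := measurable_const_mul S
  have hpos : 0 < ‖S.det‖ ^ (2 * q) := pow_pos (norm_pos_iff.mpr hS.ne_zero) _
  have hwf : Measurable fun T : Matrix (Fin q) (Fin q) ℂ =>
      ENNReal.ofReal ((‖(S * T).det‖ ^ (2 * q))⁻¹) * f (S * T) := (hw.mul hf).comp hc
  unfold generalLinearHaar
  rw [lintegral_withDensity_eq_lintegral_mul _ hw (g := fun T => f (S * T)) (hf.comp hc),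
    lintegral_withDensity_eq_lintegral_mul _ hw hf,
    ← lintegral_matrixLebesgue_mul hS (hw.mul hf)]
  simp only [Pi.mul_apply]
  rw [← lintegral_const_mul _ hwf]
  refine lintegral_congr fun T => ?_
  rw [Matrix.det_mul, norm_mul, mul_pow, mul_inv, ENNReal.ofReal_mul (by positivity), ← mul_assoc,
    ← mul_assoc, ← ENNReal.ofReal_mul hpos.le, mul_inv_cancel₀ hpos.ne', ENNReal.ofReal_one,
    one_mul]

/-- A measure `μ` on the positive definite cone that is invariant under all congruences
`X ↦ T X T*` is proportional to the image of the Haar measure of `GL_q(ℂ)` under `T ↦ T* T`. With a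
test function `φ`, this follows by evaluating `∫∫ f(T* X T) φ(T* T) dμ(X) dT` in both orders. -/
theorem lintegral_mul_eq_of_congruence_invariant {q : ℕ} (μ : Measure (Matrix (Fin q) (Fin q) ℂ))
    [SFinite μ] (hpd : ∀ᵐ X ∂μ, X.PosDef)
    (hinv : ∀ T : Matrix (Fin q) (Fin q) ℂ, IsUnit T.det →
      ∀ f : Matrix (Fin q) (Fin q) ℂ → ENNReal, Measurable f →
        ∫⁻ X, f (T * X * Tᴴ) ∂μ = ∫⁻ X, f X ∂μ)
    {f φ : Matrix (Fin q) (Fin q) ℂ → ENNReal} (hf : Measurable f) (hφ : Measurable φ) :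
    (∫⁻ X, f X ∂μ) * ∫⁻ T, φ (Tᴴ * T) ∂(generalLinearHaar q) =
      (∫⁻ X, φ X⁻¹ ∂μ) * ∫⁻ T, f (Tᴴ * T) ∂(generalLinearHaar q) := by
  set ν := generalLinearHaar q
  have hTT : Measurable fun T : Matrix (Fin q) (Fin q) ℂ => Tᴴ * T :=
    (continuous_id.matrix_conjTranspose.matrix_mul continuous_id).measurable
  have hH : Measurable fun T : Matrix (Fin q) (Fin q) ℂ => Tᴴ :=
    continuous_id.matrix_conjTranspose.measurable
  have hinvm := measurable_matrix_inv (q := q)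
  calc (∫⁻ X, f X ∂μ) * ∫⁻ T, φ (Tᴴ * T) ∂ν
      = ∫⁻ T, (∫⁻ X, f X ∂μ) * φ (Tᴴ * T) ∂ν := (lintegral_const_mul _ (hφ.comp hTT)).symm
    _ = ∫⁻ T, ∫⁻ X, f (Tᴴ * X * T) * φ (Tᴴ * T) ∂μ ∂ν := by
        refine lintegral_congr_ae ?_
        filter_upwards [ae_isUnit_det_generalLinearHaar q] with T hT
        have hT' : IsUnit (Tᴴ).det := by rw [Matrix.det_conjTranspose]; exact hT.star
        have hm : Measurable fun X : Matrix (Fin q) (Fin q) ℂ => Tᴴ * X * T :=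
          (measurable_id.const_mul _).mul_const _
        have hfm : Measurable fun X : Matrix (Fin q) (Fin q) ℂ => f (Tᴴ * X * T) := hf.comp hm
        rw [lintegral_mul_const _ hfm, ← hinv Tᴴ hT' f hf,
          Matrix.conjTranspose_conjTranspose]
    _ = ∫⁻ X, ∫⁻ T, f (Tᴴ * X * T) * φ (Tᴴ * T) ∂ν ∂μ := by
        refine lintegral_lintegral_swap (Measurable.aemeasurable ?_)
        exact (hf.comp (((hH.comp measurable_fst).mul measurable_snd).mul measurable_fst)).mul
          (hφ.comp (hTT.comp measurable_fst))
    _ = ∫⁻ X, ∫⁻ T, f (Tᴴ * T) * φ (Tᴴ * X⁻¹ * T) ∂ν ∂μ := by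
        refine lintegral_congr_ae ?_
        filter_upwards [hpd] with X hX
        -- Substitute `T ↦ R T` with `R` the square root of `X`, so that `T* X T = (R T)* (R T)`.
        set R := CFC.sqrt X
        have hRR : R * R = X := CFC.sqrt_mul_sqrt_self X hX.posSemidef.nonneg
        have hRH : Rᴴ = R := (Matrix.nonneg_iff_posSemidef.mp (CFC.sqrt_nonneg X)).isHermitian
        have hXu : IsUnit X.det := (Matrix.isUnit_iff_isUnit_det _).mp hX.isUnit
        have hRu : IsUnit R.det := by
          rw [← hRR, Matrix.det_mul] at hXu
          exact isUnit_of_mul_isUnit_left hXu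
        have hm : Measurable fun T : Matrix (Fin q) (Fin q) ℂ =>
            f (Tᴴ * T) * φ (Tᴴ * X⁻¹ * T) :=
          (hf.comp hTT).mul (hφ.comp ((hH.mul_const _).mul measurable_id))
        rw [← lintegral_generalLinearHaar_mul hRu hm]
        refine lintegral_congr fun T => ?_
        have h1 : (R * T)ᴴ * (R * T) = Tᴴ * X * T := by
          rw [Matrix.conjTranspose_mul, hRH, ← hRR]; simp only [Matrix.mul_assoc]
        have h2 : (R * T)ᴴ * X⁻¹ * (R * T) = Tᴴ * T := by
          have : R * X⁻¹ * R = 1 := by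
            rw [← hRR, Matrix.mul_inv_rev, ← Matrix.mul_assoc, Matrix.mul_nonsing_inv _ hRu,
              Matrix.one_mul, Matrix.nonsing_inv_mul _ hRu]
          calc (R * T)ᴴ * X⁻¹ * (R * T) = Tᴴ * (R * X⁻¹ * R) * T := by
                rw [Matrix.conjTranspose_mul, hRH]; simp only [Matrix.mul_assoc]
            _ = Tᴴ * T := by rw [this, Matrix.mul_one]
        rw [h1, h2]
    _ = ∫⁻ T, ∫⁻ X, f (Tᴴ * T) * φ (Tᴴ * X⁻¹ * T) ∂μ ∂ν := by
        refine lintegral_lintegral_swap (Measurable.aemeasurable ?_)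
        exact (hf.comp (hTT.comp measurable_snd)).mul
          (hφ.comp (((hH.comp measurable_snd).mul (hinvm.comp measurable_fst)).mul measurable_snd))
    _ = ∫⁻ T, (∫⁻ X, φ X⁻¹ ∂μ) * f (Tᴴ * T) ∂ν := by
        refine lintegral_congr_ae ?_
        filter_upwards [ae_isUnit_det_generalLinearHaar q] with T hT
        have hm : Measurable fun X : Matrix (Fin q) (Fin q) ℂ => φ (Tᴴ * X⁻¹ * T) :=
          hφ.comp ((hinvm.const_mul _).mul_const _)
        have hT' : IsUnit (T⁻¹).det := Matrix.isUnit_nonsing_inv_det T hT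
        -- Since `T* X⁻¹ T = (T⁻¹ X T⁻*)⁻¹`, invariance of `μ` removes the dependence on `T`.
        rw [lintegral_const_mul _ hm, mul_comm,
          ← hinv T⁻¹ hT' (fun X => φ X⁻¹) (hφ.comp hinvm)]
        congr 1
        refine lintegral_congr fun X => ?_
        rw [Matrix.mul_inv_rev, Matrix.mul_inv_rev, Matrix.conjTranspose_nonsing_inv,
          Matrix.nonsing_inv_nonsing_inv _ hT, Matrix.nonsing_inv_nonsing_inv _
          (by rw [Matrix.det_conjTranspose]; exact hT.star), Matrix.mul_assoc]
    _ = (∫⁻ X, φ X⁻¹ ∂μ) * ∫⁻ T, f (Tᴴ * T) ∂ν := lintegral_const_mul _ (hf.comp hTT)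

/-- The measure `det X^{-q} dX` on the cone of positive definite matrices. -/
noncomputable def coneMeasure (q : ℕ) : Measure (Matrix (Fin q) (Fin q) ℂ) :=
  ((hermitianLebesgue q).restrict {X | X.PosDef}).withDensity
    fun X => ENNReal.ofReal ((X.det.re ^ q)⁻¹)

instance coneMeasure_sFinite (q : ℕ) : SFinite (coneMeasure q) := by
  unfold coneMeasure; infer_instance

theorem measurable_det_re_pow (q k : ℕ) :
    Measurable fun X : Matrix (Fin q) (Fin q) ℂ => X.det.re ^ k :=
  (Complex.measurable_re.comp measurable_det).pow_const k

theorem lintegral_coneMeasure {q : ℕ} {f : Matrix (Fin q) (Fin q) ℂ → ENNReal}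
    (hf : Measurable f) :
    ∫⁻ X, f X ∂(coneMeasure q) = ∫⁻ X, {X : Matrix (Fin q) (Fin q) ℂ | X.PosDef}.indicator
      (fun X => ENNReal.ofReal ((X.det.re ^ q)⁻¹) * f X) X ∂(hermitianLebesgue q) := by
  have hw : Measurable fun X : Matrix (Fin q) (Fin q) ℂ => ENNReal.ofReal ((X.det.re ^ q)⁻¹) :=
    (measurable_det_re_pow q q).inv.ennreal_ofReal
  unfold coneMeasure
  rw [lintegral_withDensity_eq_lintegral_mul _ hw hf,
    lintegral_indicator (measurableSet_posDef q)]
  rfl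

theorem posDef_mul_mul_conjTranspose_iff {q : ℕ} {T X : Matrix (Fin q) (Fin q) ℂ}
    (hT : IsUnit T.det) : (T * X * Tᴴ).PosDef ↔ X.PosDef :=
  Matrix.IsUnit.posDef_star_right_conjugate_iff ((Matrix.isUnit_iff_isUnit_det T).mpr hT)

theorem lintegral_coneMeasure_congruence {q : ℕ} (T : Matrix (Fin q) (Fin q) ℂ)
    (hT : IsUnit T.det) (f : Matrix (Fin q) (Fin q) ℂ → ENNReal) (hf : Measurable f) :
    ∫⁻ X, f (T * X * Tᴴ) ∂(coneMeasure q) = ∫⁻ X, f X ∂(coneMeasure q) := by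
  have hpos : 0 < ‖T.det‖ ^ (2 * q) := pow_pos (norm_pos_iff.mpr hT.ne_zero) _
  have hm : Measurable fun X : Matrix (Fin q) (Fin q) ℂ => T * X * Tᴴ :=
    (measurable_id.const_mul _).mul_const _
  have hg : Measurable ({X : Matrix (Fin q) (Fin q) ℂ | X.PosDef}.indicator
      (fun X => ENNReal.ofReal ((X.det.re ^ q)⁻¹) * f X)) :=
    ((measurable_det_re_pow q q).inv.ennreal_ofReal.mul hf).indicator (measurableSet_posDef q)
  have hgm : Measurable fun X => ({X : Matrix (Fin q) (Fin q) ℂ | X.PosDef}.indicator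
      (fun X => ENNReal.ofReal ((X.det.re ^ q)⁻¹) * f X)) (T * X * Tᴴ) := hg.comp hm
  rw [lintegral_coneMeasure (f := fun X => f (T * X * Tᴴ)) (hf.comp hm), lintegral_coneMeasure hf,
    ← lintegral_hermitianLebesgue_congruence hT hg, ← lintegral_const_mul _ hgm]
  classical
  refine lintegral_congr fun X => ?_
  simp only [Set.indicator_apply, Set.mem_ofPred_eq,
    posDef_mul_mul_conjTranspose_iff hT]
  split_ifs with hX
  · rw [det_conj_mul_mul_re, mul_pow, ← pow_mul, mul_inv, ENNReal.ofReal_mul (by positivity),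
      ← mul_assoc, ← mul_assoc, ← ENNReal.ofReal_mul hpos.le, mul_inv_cancel₀ hpos.ne',
      ENNReal.ofReal_one, one_mul]
  · simp

theorem ae_posDef_coneMeasure (q : ℕ) : ∀ᵐ X ∂(coneMeasure q), X.PosDef :=
  (withDensity_absolutelyContinuous _ _).ae_le (ae_restrict_mem (measurableSet_posDef q))

/-- The image under `A ↦ A A*` of the measure `det (A A*)^{-p} dA` on `q × p` matrices. -/
noncomputable def rectangularMeasure (q p : ℕ) : Measure (Matrix (Fin q) (Fin q) ℂ) :=
  ((matrixLebesgue q p).withDensity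
    fun A => ENNReal.ofReal (((A * Aᴴ).det.re ^ p)⁻¹)).map fun A => A * Aᴴ

instance rectangularMeasure_sFinite (q p : ℕ) : SFinite (rectangularMeasure q p) := by
  unfold rectangularMeasure; infer_instance

theorem lintegral_rectangularMeasure {q p : ℕ} {f : Matrix (Fin q) (Fin q) ℂ → ENNReal}
    (hf : Measurable f) :
    ∫⁻ X, f X ∂(rectangularMeasure q p) = ∫⁻ A, ENNReal.ofReal (((A * Aᴴ).det.re ^ p)⁻¹) *
      f (A * Aᴴ) ∂(matrixLebesgue q p) := by
  have hm := measurable_mul_conjTranspose (q := q) (p := p)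
  have hw : Measurable fun A : Matrix (Fin q) (Fin p) ℂ =>
      ENNReal.ofReal (((A * Aᴴ).det.re ^ p)⁻¹) :=
    (measurable_det_re_pow q p).inv.ennreal_ofReal.comp hm
  have hfm : Measurable fun A : Matrix (Fin q) (Fin p) ℂ => f (A * Aᴴ) := hf.comp hm
  unfold rectangularMeasure
  rw [lintegral_map hf hm, lintegral_withDensity_eq_lintegral_mul _ hw hfm]
  rfl

theorem lintegral_rectangularMeasure_congruence {q p : ℕ} (T : Matrix (Fin q) (Fin q) ℂ)
    (hT : IsUnit T.det) (f : Matrix (Fin q) (Fin q) ℂ → ENNReal) (hf : Measurable f) :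
    ∫⁻ X, f (T * X * Tᴴ) ∂(rectangularMeasure q p) = ∫⁻ X, f X ∂(rectangularMeasure q p) := by
  have hpos : 0 < ‖T.det‖ ^ (2 * p) := pow_pos (norm_pos_iff.mpr hT.ne_zero) _
  have hm : Measurable fun X : Matrix (Fin q) (Fin q) ℂ => T * X * Tᴴ :=
    (measurable_id.const_mul _).mul_const _
  have hA := measurable_mul_conjTranspose (q := q) (p := p)
  have hTA : Measurable fun A : Matrix (Fin q) (Fin p) ℂ => T * A :=
    (continuous_const.matrix_mul continuous_id).measurable
  have hg : Measurable fun A : Matrix (Fin q) (Fin p) ℂ =>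
      ENNReal.ofReal (((A * Aᴴ).det.re ^ p)⁻¹) * f (A * Aᴴ) :=
    ((measurable_det_re_pow q p).inv.ennreal_ofReal.mul hf).comp hA
  have hgm : Measurable fun A : Matrix (Fin q) (Fin p) ℂ =>
      ENNReal.ofReal (((T * A * (T * A)ᴴ).det.re ^ p)⁻¹) * f (T * A * (T * A)ᴴ) := hg.comp hTA
  rw [lintegral_rectangularMeasure (f := fun X => f (T * X * Tᴴ)) (hf.comp hm),
    lintegral_rectangularMeasure hf, ← lintegral_matrixLebesgue_mul hT hg,
    ← lintegral_const_mul _ hgm]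
  refine lintegral_congr fun A => ?_
  have h : T * A * (T * A)ᴴ = T * (A * Aᴴ) * Tᴴ := by
    rw [Matrix.conjTranspose_mul]; simp only [Matrix.mul_assoc]
  rw [h, det_conj_mul_mul_re, mul_pow, ← pow_mul, mul_inv, ENNReal.ofReal_mul (by positivity),
    ← mul_assoc, ← mul_assoc, ← ENNReal.ofReal_mul hpos.le, mul_inv_cancel₀ hpos.ne',
    ENNReal.ofReal_one, one_mul]

theorem ae_posDef_rectangularMeasure {q p : ℕ} (hqp : q ≤ p) :
    ∀ᵐ X ∂(rectangularMeasure q p), X.PosDef := by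
  unfold rectangularMeasure
  rw [ae_map_iff measurable_mul_conjTranspose.aemeasurable (measurableSet_posDef q)]
  exact (withDensity_absolutelyContinuous _ _).ae_le (ae_posDef_mul_conjTranspose hqp)

/-! ### A test set for the invariant measures -/

/-- The positive definite matrices `X` such that the entries of `X` and `X⁻¹` are smaller than `2`
in absolute value: a set of positive finite measure for the invariant measures. -/
def boundedCone (q : ℕ) : Set (Matrix (Fin q) (Fin q) ℂ) :=
  {X | X.PosDef ∧ (∀ i j, ‖X i j‖ < 2) ∧ ∀ i j, ‖X⁻¹ i j‖ < 2}

theorem measurableSet_boundedCone (q : ℕ) : MeasurableSet (boundedCone q) := by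
  have hent : MeasurableSet {X : Matrix (Fin q) (Fin q) ℂ | ∀ i j, ‖X i j‖ < 2} := by
    simp only [Set.ofPred_forall]
    refine MeasurableSet.iInter fun i => MeasurableSet.iInter fun j => ?_
    have : Measurable fun X : Matrix (Fin q) (Fin q) ℂ => ‖X i j‖ :=
      ((measurable_pi_apply j).comp (measurable_pi_apply i)).norm
    exact measurableSet_lt this measurable_const
  exact (measurableSet_posDef q).inter (hent.inter (measurable_matrix_inv hent))

theorem inv_mem_boundedCone {q : ℕ} {X : Matrix (Fin q) (Fin q) ℂ} :
    X⁻¹ ∈ boundedCone q ↔ X ∈ boundedCone q := by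
  have h : ∀ {X : Matrix (Fin q) (Fin q) ℂ}, X ∈ boundedCone q → X⁻¹ ∈ boundedCone q := by
    rintro X ⟨h1, h2, h3⟩
    refine ⟨h1.inv, h3, ?_⟩
    rwa [Matrix.nonsing_inv_nonsing_inv _ ((Matrix.isUnit_iff_isUnit_det _).mp h1.isUnit)]
  refine ⟨fun hX => ?_, h⟩
  have h1 : X.PosDef := Matrix.posDef_inv_iff.mp hX.1
  have := h hX
  rwa [Matrix.nonsing_inv_nonsing_inv _ ((Matrix.isUnit_iff_isUnit_det _).mp h1.isUnit)] at this

open scoped Matrix.Norms.L2Operator in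
theorem eventually_isHermitian_imp_posDef (q : ℕ) :
    ∀ᶠ X in nhds (1 : Matrix (Fin q) (Fin q) ℂ), X.IsHermitian → X.PosDef := by
  filter_upwards [Metric.ball_mem_nhds (1 : Matrix (Fin q) (Fin q) ℂ) one_pos] with X hX hXh
  rw [Metric.mem_ball, dist_comm, dist_eq_norm] at hX
  have hsa : IsSelfAdjoint (1 - X) := (Matrix.isHermitian_one.sub hXh)
  have h1 := hsa.le_algebraMap_norm_self
  have h2 : (algebraMap ℝ (Matrix (Fin q) (Fin q) ℂ) ‖1 - X‖ - (1 - X)).PosSemidef := h1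
  have h3 : (((1 - ‖1 - X‖ : ℝ)) • (1 : Matrix (Fin q) (Fin q) ℂ)).PosDef :=
    Matrix.PosDef.one.smul (sub_pos.mpr hX)
  have h4 := h3.add_posSemidef h2
  convert h4 using 1
  rw [Algebra.algebraMap_eq_smul_one, sub_smul, one_smul]
  abel

theorem eventually_isHermitian_imp_mem_boundedCone (q : ℕ) :
    ∀ᶠ X in nhds (1 : Matrix (Fin q) (Fin q) ℂ), X.IsHermitian → X ∈ boundedCone q := by
  have hent : ∀ᶠ X in nhds (1 : Matrix (Fin q) (Fin q) ℂ), ∀ i j, ‖X i j‖ < 2 := by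
    refine Filter.eventually_all.mpr fun i => Filter.eventually_all.mpr fun j => ?_
    have hc : Continuous fun X : Matrix (Fin q) (Fin q) ℂ => ‖X i j‖ := by fun_prop
    refine (isOpen_lt hc continuous_const).mem_nhds ?_
    by_cases hij : i = j <;> simp [hij]
  have hinv : ContinuousAt (fun X : Matrix (Fin q) (Fin q) ℂ => X⁻¹) 1 := by
    refine continuousAt_matrix_inv _ ?_
    rw [Matrix.det_one, Ring.inverse_eq_inv']
    exact continuousAt_inv₀ one_ne_zero
  have hent' : ∀ᶠ X in nhds (1 : Matrix (Fin q) (Fin q) ℂ), ∀ i j, ‖X⁻¹ i j‖ < 2 := by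
    have h1 : (1 : Matrix (Fin q) (Fin q) ℂ)⁻¹ = 1 := inv_one
    have := hinv.tendsto
    rw [h1] at this
    exact this.eventually hent
  filter_upwards [hent, hent', eventually_isHermitian_imp_posDef q] with X h1 h2 h3 hX
  exact ⟨h3 hX, h1, h2⟩

theorem inv_det_re_le_of_mem_boundedCone {q : ℕ} {X : Matrix (Fin q) (Fin q) ℂ}
    (hX : X ∈ boundedCone q) : (X.det.re)⁻¹ ≤ (q.factorial : ℝ) * 2 ^ q := by
  have hre : ((X.det.re : ℝ) : ℂ) = X.det :=
    (Complex.eq_re_of_ofReal_le hX.1.det_pos.le).symm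
  have h := Matrix.det_le (A := X⁻¹) (abv := IsAbsoluteValue.toAbsoluteValue (norm : ℂ → ℝ))
    (x := 2) fun i j => (hX.2.2 i j).le
  have h2 : ‖(X⁻¹).det‖ = (X.det.re)⁻¹ := by
    rw [Matrix.det_nonsing_inv, Ring.inverse_eq_inv', norm_inv]
    conv_lhs => rw [← hre]
    rw [Complex.norm_real, Real.norm_of_nonneg hX.1.det_re_pos.le]
  rw [← h2]
  simpa using h

theorem setLIntegral_lt_top_of_le {α : Type*} [MeasurableSpace α] {μ : Measure α} {s t : Set α}
    {w : α → ENNReal} {C : ENNReal} (hs : MeasurableSet s) (hC : C ≠ ⊤) (hw : ∀ x ∈ s, w x ≤ C)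
    (hst : s ⊆ t) (ht : μ t < ⊤) : ∫⁻ x in s, w x ∂μ < ⊤ :=
  calc ∫⁻ x in s, w x ∂μ ≤ ∫⁻ _ in s, C ∂μ := setLIntegral_mono' hs hw
    _ = C * μ s := setLIntegral_const s C
    _ < ⊤ := ENNReal.mul_lt_top hC.lt_top ((measure_mono hst).trans_lt ht)

theorem coneMeasure_boundedCone_lt_top (q : ℕ) : coneMeasure q (boundedCone q) < ⊤ := by
  have hK := measurableSet_boundedCone q
  rw [coneMeasure, withDensity_apply _ hK]
  refine setLIntegral_lt_top_of_le (t := {X | ∀ i j, ‖X i j‖ ≤ 2})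
    (C := ENNReal.ofReal (((q.factorial : ℝ) * 2 ^ q) ^ q)) hK ENNReal.ofReal_ne_top
    (fun X hX => ?_) (fun X hX i j => (hX.2.1 i j).le) ?_
  · refine ENNReal.ofReal_le_ofReal ?_
    rw [← inv_pow]
    exact pow_le_pow_left₀ (inv_nonneg.mpr hX.1.det_re_pos.le)
      (inv_det_re_le_of_mem_boundedCone hX) q
  · have hclosed : MeasurableSet {X : Matrix (Fin q) (Fin q) ℂ | ∀ i j, ‖X i j‖ ≤ 2} := by
      simp only [Set.ofPred_forall]
      refine MeasurableSet.iInter fun i => MeasurableSet.iInter fun j => ?_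
      have : Continuous fun X : Matrix (Fin q) (Fin q) ℂ => ‖X i j‖ := by fun_prop
      exact (isClosed_le this continuous_const).measurableSet
    refine (Measure.restrict_apply_le _ _).trans_lt ?_
    rw [hermitianLebesgue, Measure.map_apply measurable_hermitianOfCoords hclosed]
    refine (measure_mono ?_).trans_lt
      (measure_closedBall_lt_top (x := (0 : Fin q → Fin q → ℝ)) (r := 2))
    intro x hx
    rw [mem_closedBall_zero_iff, pi_norm_le_iff_of_nonneg zero_le_two]
    intro i
    rw [pi_norm_le_iff_of_nonneg zero_le_two]
    intro j
    rw [← hermitianCoords_hermitianOfCoords x]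
    exact abs_hermitianCoords_le _ hx i j

theorem coneMeasure_boundedCone_ne_zero (q : ℕ) : coneMeasure q (boundedCone q) ≠ 0 := by
  have hK := measurableSet_boundedCone q
  rw [coneMeasure, withDensity_apply _ hK, Measure.restrict_restrict hK,
    Set.inter_eq_left.mpr (fun X hX => hX.1)]
  have hw : Measurable fun X : Matrix (Fin q) (Fin q) ℂ => ENNReal.ofReal ((X.det.re ^ q)⁻¹) :=
    (measurable_det_re_pow q q).inv.ennreal_ofReal
  refine (setLIntegral_pos_iff hw).mpr ?_ |>.ne'
  have hsub : boundedCone q ⊆ (Function.support fun X : Matrix (Fin q) (Fin q) ℂ =>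
      ENNReal.ofReal ((X.det.re ^ q)⁻¹)) ∩ boundedCone q := fun X hX =>
    ⟨by
      have := hX.1.det_re_pos
      simp only [Function.mem_support, ne_eq, ENNReal.ofReal_eq_zero, not_le]
      positivity, hX⟩
  refine lt_of_lt_of_le ?_ (measure_mono hsub)
  rw [hermitianLebesgue, Measure.map_apply measurable_hermitianOfCoords hK]
  refine Measure.measure_pos_of_mem_nhds volume
    (x := hermitianCoords (1 : Matrix (Fin q) (Fin q) ℂ)) ?_
  have h1 : hermitianOfCoords (hermitianCoords (1 : Matrix (Fin q) (Fin q) ℂ)) = 1 :=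
    hermitianOfCoords_hermitianCoords Matrix.isHermitian_one
  have hc := (continuous_hermitianOfCoords (q := q)).tendsto (hermitianCoords 1)
  rw [h1] at hc
  filter_upwards [hc.eventually (eventually_isHermitian_imp_mem_boundedCone q)] with x hx
  exact hx (isHermitian_hermitianOfCoords x)

theorem continuous_conjTranspose_mul_self (q : ℕ) :
    Continuous fun T : Matrix (Fin q) (Fin q) ℂ => Tᴴ * T :=
  continuous_id.matrix_conjTranspose.matrix_mul continuous_id

theorem norm_entry_le_two_of_mem_boundedCone {q : ℕ} {T : Matrix (Fin q) (Fin q) ℂ}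
    (hT : Tᴴ * T ∈ boundedCone q) (i j : Fin q) : ‖T i j‖ ≤ 2 := by
  have h1 : ‖T i j‖ ^ 2 ≤ ‖(Tᴴ * T) j j‖ := by
    have h2 : (Tᴴ * T) j j = ((∑ k, ‖T k j‖ ^ 2 : ℝ) : ℂ) := by
      rw [Matrix.mul_apply, Complex.ofReal_sum]
      refine Finset.sum_congr rfl fun k _ => ?_
      rw [Matrix.conjTranspose_apply, RCLike.star_def, ← Complex.normSq_eq_conj_mul_self,
        Complex.normSq_eq_norm_sq]
    rw [h2, Complex.norm_real, Real.norm_of_nonneg (Finset.sum_nonneg fun _ _ => by positivity)]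
    exact Finset.single_le_sum (f := fun k => ‖T k j‖ ^ 2) (fun _ _ => by positivity)
      (Finset.mem_univ i)
  have h3 := hT.2.1 j j
  nlinarith [norm_nonneg (T i j)]

theorem generalLinearHaar_boundedCone_lt_top (q : ℕ) :
    generalLinearHaar q {T | Tᴴ * T ∈ boundedCone q} < ⊤ := by
  have hK : MeasurableSet {T : Matrix (Fin q) (Fin q) ℂ | Tᴴ * T ∈ boundedCone q} :=
    (continuous_conjTranspose_mul_self q).measurable (measurableSet_boundedCone q)
  rw [generalLinearHaar, withDensity_apply _ hK]
  refine setLIntegral_lt_top_of_le (t := {X | ∀ i j, ‖X i j‖ ≤ 2})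
    (C := ENNReal.ofReal (((q.factorial : ℝ) * 2 ^ q) ^ q)) hK ENNReal.ofReal_ne_top
    (fun T hT => ?_) (fun T hT => norm_entry_le_two_of_mem_boundedCone hT) ?_
  · refine ENNReal.ofReal_le_ofReal ?_
    have h : (Tᴴ * T).det.re = ‖T.det‖ ^ 2 := by
      rw [Matrix.det_mul, Matrix.det_conjTranspose, RCLike.star_def,
        ← Complex.normSq_eq_conj_mul_self, Complex.normSq_eq_norm_sq, Complex.ofReal_re]
    rw [pow_mul, ← h, ← inv_pow]
    exact pow_le_pow_left₀ (inv_nonneg.mpr hT.1.det_re_pos.le)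
      (inv_det_re_le_of_mem_boundedCone hT) q
  · refine (measure_mono ?_).trans_lt (measure_closedBall_lt_top
      (μ := (volume : Measure (Fin q → Fin q → ℂ))) (x := (0 : Fin q → Fin q → ℂ)) (r := 2))
    intro x hx
    refine (mem_closedBall_zero_iff (E := Fin q → Fin q → ℂ)).mpr
      ((pi_norm_le_iff_of_nonneg zero_le_two).mpr fun i => ?_)
    exact (pi_norm_le_iff_of_nonneg zero_le_two).mpr (hx i)

theorem generalLinearHaar_boundedCone_ne_zero (q : ℕ) :
    generalLinearHaar q {T | Tᴴ * T ∈ boundedCone q} ≠ 0 := by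
  have hK : MeasurableSet {T : Matrix (Fin q) (Fin q) ℂ | Tᴴ * T ∈ boundedCone q} :=
    (continuous_conjTranspose_mul_self q).measurable (measurableSet_boundedCone q)
  rw [generalLinearHaar, withDensity_apply _ hK]
  refine (setLIntegral_pos_iff (measurable_generalLinearHaar_density q)).mpr ?_ |>.ne'
  have hsub : {T : Matrix (Fin q) (Fin q) ℂ | Tᴴ * T ∈ boundedCone q} ⊆
      (Function.support fun T : Matrix (Fin q) (Fin q) ℂ =>
        ENNReal.ofReal ((‖T.det‖ ^ (2 * q))⁻¹)) ∩ {T | Tᴴ * T ∈ boundedCone q} := fun T hT =>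
    ⟨by
      have h1 : (Tᴴ * T).det ≠ 0 := hT.1.det_pos.ne'
      rw [Matrix.det_mul] at h1
      have : 0 < ‖T.det‖ := norm_pos_iff.mpr (right_ne_zero_of_mul h1)
      simp only [Function.mem_support, ne_eq, ENNReal.ofReal_eq_zero, not_le]
      positivity, hT⟩
  refine lt_of_lt_of_le ?_ (measure_mono hsub)
  refine Measure.measure_pos_of_mem_nhds (volume : Measure (Fin q → Fin q → ℂ))
    (x := (1 : Matrix (Fin q) (Fin q) ℂ)) ?_
  have hc := (continuous_conjTranspose_mul_self q).tendsto 1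
  rw [Matrix.conjTranspose_one, Matrix.one_mul] at hc
  change ∀ᶠ T in nhds (1 : Matrix (Fin q) (Fin q) ℂ), Tᴴ * T ∈ boundedCone q
  filter_upwards [hc.eventually (eventually_isHermitian_imp_mem_boundedCone q)] with T hT
  exact hT (Matrix.isHermitian_conjTranspose_mul_self T)

/-! ### The Wishart density -/

/-- The unnormalized Wishart density: for `q ≤ p`, the image of Lebesgue measure under
`A ↦ A A*` is proportional to `det X^{p-q} dX` on the positive definite cone. The factor `C` is not
asserted to be finite or nonzero: in the laws below it is determined by the total mass. -/
theorem exists_lintegral_mul_conjTranspose {q p : ℕ} (hqp : q ≤ p) :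
    ∃ C : ENNReal, ∀ f : Matrix (Fin q) (Fin q) ℂ → ENNReal, Measurable f →
      ∫⁻ A, f (A * Aᴴ) ∂(matrixLebesgue q p) =
        C * ∫⁻ X, {X : Matrix (Fin q) (Fin q) ℂ | X.PosDef}.indicator
          (fun X => ENNReal.ofReal (X.det.re ^ (p - q)) * f X) X ∂(hermitianLebesgue q) := by
  classical
  have hK := measurableSet_boundedCone q
  set φ : Matrix (Fin q) (Fin q) ℂ → ENNReal := (boundedCone q).indicator 1 with hφ
  have hφm : Measurable φ := measurable_one.indicator hK
  have hTT := (continuous_conjTranspose_mul_self q).measurable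
  have ha : ∫⁻ T, φ (Tᴴ * T) ∂(generalLinearHaar q) =
      generalLinearHaar q {T | Tᴴ * T ∈ boundedCone q} := by
    have hS : MeasurableSet {T : Matrix (Fin q) (Fin q) ℂ | Tᴴ * T ∈ boundedCone q} := hTT hK
    rw [← lintegral_indicator_one hS]
    rfl
  have hb : ∫⁻ X, φ X⁻¹ ∂(coneMeasure q) = coneMeasure q (boundedCone q) := by
    rw [← lintegral_indicator_one hK]
    refine lintegral_congr fun X => ?_
    simp only [hφ, Set.indicator_apply, inv_mem_boundedCone, Pi.one_apply]
  set b' := ∫⁻ X, φ X⁻¹ ∂(rectangularMeasure q p)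
  refine ⟨b' * (coneMeasure q (boundedCone q))⁻¹, fun f hf => ?_⟩
  -- Integrating `det X^p f` against the invariant measures turns `det (A A*)^{-p} dA` into `dA`
  -- and `det X^{-q} dX` into `det X^{p-q} dX`.
  set F : Matrix (Fin q) (Fin q) ℂ → ENNReal := fun X => ENNReal.ofReal (X.det.re ^ p) * f X
  have hF : Measurable F := (measurable_det_re_pow q p).ennreal_ofReal.mul hf
  have e1 : ∫⁻ A, f (A * Aᴴ) ∂(matrixLebesgue q p) = ∫⁻ X, F X ∂(rectangularMeasure q p) := by
    rw [lintegral_rectangularMeasure hF]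
    refine lintegral_congr_ae ?_
    filter_upwards [ae_posDef_mul_conjTranspose hqp] with A hA
    have hd : 0 < (A * Aᴴ).det.re ^ p := pow_pos hA.det_re_pos p
    simp only [F]
    rw [← mul_assoc, ← ENNReal.ofReal_mul (by positivity), inv_mul_cancel₀ hd.ne',
      ENNReal.ofReal_one, one_mul]
  have e2 : ∫⁻ X, {X : Matrix (Fin q) (Fin q) ℂ | X.PosDef}.indicator
      (fun X => ENNReal.ofReal (X.det.re ^ (p - q)) * f X) X ∂(hermitianLebesgue q) =
      ∫⁻ X, F X ∂(coneMeasure q) := by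
    rw [lintegral_coneMeasure hF]
    refine lintegral_congr fun X => congrFun (Set.indicator_congr fun X hX => ?_) X
    have hd : 0 < X.det.re := Matrix.PosDef.det_re_pos hX
    simp only [F]
    rw [← mul_assoc, ← ENNReal.ofReal_mul (by positivity), pow_sub₀ _ hd.ne' hqp, mul_comm (_ ^ p)]
  rw [e1, e2]
  have h1 := lintegral_mul_eq_of_congruence_invariant (rectangularMeasure q p)
    (ae_posDef_rectangularMeasure hqp) lintegral_rectangularMeasure_congruence hF hφm
  have h2 := lintegral_mul_eq_of_congruence_invariant (coneMeasure q)
    (ae_posDef_coneMeasure q) lintegral_coneMeasure_congruence hF hφm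
  rw [ha] at h1 h2
  rw [hb] at h2
  have ha0 := generalLinearHaar_boundedCone_ne_zero q
  have hat := (generalLinearHaar_boundedCone_lt_top q).ne
  have hb0 := coneMeasure_boundedCone_ne_zero q
  have hbt := (coneMeasure_boundedCone_lt_top q).ne
  set a := generalLinearHaar q {T | Tᴴ * T ∈ boundedCone q}
  set b := coneMeasure q (boundedCone q)
  set ν := ∫⁻ T, F (Tᴴ * T) ∂(generalLinearHaar q)
  have h3 : (∫⁻ X, F X ∂(rectangularMeasure q p)) * b * a =
      b' * (∫⁻ X, F X ∂(coneMeasure q)) * a := by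
    rw [mul_right_comm, h1, mul_assoc, mul_assoc, h2, mul_comm ν b]
  have h4 := (ENNReal.mul_left_inj ha0 hat).mp h3
  calc ∫⁻ X, F X ∂(rectangularMeasure q p)
      = (∫⁻ X, F X ∂(rectangularMeasure q p)) * b * b⁻¹ := by
        rw [mul_assoc, ENNReal.mul_inv_cancel hb0 hbt, mul_one]
    _ = b' * b⁻¹ * ∫⁻ X, F X ∂(coneMeasure q) := by rw [h4]; ring

/-! ### The density of the matrix `J` -/

/-- The function `det X ^ k` on the positive definite cone, extended by `0`. -/
noncomputable def detPowOnCone {q : ℕ} (k : ℕ) : Matrix (Fin q) (Fin q) ℂ → ENNReal :=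
  {X : Matrix (Fin q) (Fin q) ℂ | X.PosDef}.indicator fun X => ENNReal.ofReal (X.det.re ^ k)

theorem measurable_detPowOnCone {q : ℕ} (k : ℕ) :
    Measurable (detPowOnCone k : Matrix (Fin q) (Fin q) ℂ → ENNReal) :=
  (measurable_det_re_pow q k).ennreal_ofReal.indicator (measurableSet_posDef q)

theorem detPowOnCone_of_posDef {q k : ℕ} {X : Matrix (Fin q) (Fin q) ℂ} (hX : X.PosDef) :
    detPowOnCone k X = ENNReal.ofReal (X.det.re ^ k) :=
  Set.indicator_of_mem (s := {X : Matrix (Fin q) (Fin q) ℂ | X.PosDef}) hX _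

theorem detPowOnCone_of_not_posDef {q k : ℕ} {X : Matrix (Fin q) (Fin q) ℂ} (hX : ¬ X.PosDef) :
    detPowOnCone k X = 0 :=
  Set.indicator_of_notMem (s := {X : Matrix (Fin q) (Fin q) ℂ | X.PosDef}) hX _

theorem detPowOnCone_congruence {q k : ℕ} {T : Matrix (Fin q) (Fin q) ℂ} (hT : IsUnit T.det)
    (X : Matrix (Fin q) (Fin q) ℂ) :
    detPowOnCone k (T * X * Tᴴ) = ENNReal.ofReal (‖T.det‖ ^ (2 * k)) * detPowOnCone k X := by
  by_cases hX : X.PosDef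
  · rw [detPowOnCone_of_posDef hX,
      detPowOnCone_of_posDef ((posDef_mul_mul_conjTranspose_iff hT).mpr hX), det_conj_mul_mul_re,
      mul_pow, ← pow_mul, ENNReal.ofReal_mul (by positivity)]
  · rw [detPowOnCone_of_not_posDef hX, detPowOnCone_of_not_posDef
      (fun h => hX ((posDef_mul_mul_conjTranspose_iff hT).mp h)), mul_zero]

theorem exists_lintegral_mul_conjTranspose_detPow {q p : ℕ} (hqp : q ≤ p) :
    ∃ C : ENNReal, ∀ f : Matrix (Fin q) (Fin q) ℂ → ENNReal, Measurable f →
      ∫⁻ A, f (A * Aᴴ) ∂(matrixLebesgue q p) =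
        C * ∫⁻ X, detPowOnCone (p - q) X * f X ∂(hermitianLebesgue q) := by
  obtain ⟨C, hC⟩ := exists_lintegral_mul_conjTranspose hqp
  refine ⟨C, fun f hf => ?_⟩
  rw [hC f hf]
  congr 1
  refine lintegral_congr fun X => ?_
  by_cases hX : X.PosDef
  · rw [Set.indicator_of_mem (by exact hX), detPowOnCone_of_posDef hX]
  · rw [Set.indicator_of_notMem (by exact hX), detPowOnCone_of_not_posDef hX, zero_mul]

theorem isUnit_det_sqrt {q : ℕ} {S : Matrix (Fin q) (Fin q) ℂ} (hS : S.PosDef) :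
    IsUnit (CFC.sqrt S).det := by
  have h := (Matrix.isUnit_iff_isUnit_det _).mp hS.isUnit
  rw [← CFC.sqrt_mul_sqrt_self S hS.posSemidef.nonneg, Matrix.det_mul] at h
  exact isUnit_of_mul_isUnit_left h

theorem conjTranspose_sqrt {q : ℕ} (S : Matrix (Fin q) (Fin q) ℂ) :
    (CFC.sqrt S)ᴴ = CFC.sqrt S :=
  (Matrix.nonneg_iff_posSemidef.mp (CFC.sqrt_nonneg S)).isHermitian

/-- The integral over `X`, for a fixed value `S` of the sum `X + X'`: the substitution
`X = S^{1/2} M S^{1/2}` separates `S` from `M`. -/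
theorem lintegral_jacobiTransform_fixed_sum {q : ℕ} (k l : ℕ) {S : Matrix (Fin q) (Fin q) ℂ}
    (hS : S.PosDef) {F : Matrix (Fin q) (Fin q) ℂ → ENNReal} (hF : Measurable F) :
    ∫⁻ X, detPowOnCone k X * detPowOnCone l (S - X) * F (jacobiTransform X (S - X))
        ∂(hermitianLebesgue q) =
      ENNReal.ofReal (‖(CFC.sqrt S).det‖ ^ (2 * (q + k + l))) *
        ∫⁻ M, detPowOnCone k M * detPowOnCone l (1 - M) * F M ∂(hermitianLebesgue q) := by
  set R := CFC.sqrt S with hR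
  have hRu : IsUnit R.det := isUnit_det_sqrt hS
  have hRH : Rᴴ = R := conjTranspose_sqrt S
  have hRR : R * R = S := CFC.sqrt_mul_sqrt_self S hS.posSemidef.nonneg
  have hsub : Measurable fun X : Matrix (Fin q) (Fin q) ℂ => S - X := measurable_id.const_sub S
  have hJ : Measurable fun X : Matrix (Fin q) (Fin q) ℂ => F (jacobiTransform X (S - X)) :=
    hF.comp (measurable_id.jacobiTransform hsub)
  have hm : Measurable fun X : Matrix (Fin q) (Fin q) ℂ =>
      detPowOnCone k X * detPowOnCone l (S - X) * F (jacobiTransform X (S - X)) :=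
    ((measurable_detPowOnCone k).mul ((measurable_detPowOnCone l).comp hsub)).mul hJ
  have hm' : Measurable fun M : Matrix (Fin q) (Fin q) ℂ =>
      detPowOnCone k M * detPowOnCone l (1 - M) * F M :=
    ((measurable_detPowOnCone k).mul
      ((measurable_detPowOnCone l).comp (measurable_id.const_sub 1))).mul hF
  rw [← lintegral_hermitianLebesgue_congruence hRu hm]
  have hpt : ∀ M : Matrix (Fin q) (Fin q) ℂ,
      detPowOnCone k (R * M * Rᴴ) * detPowOnCone l (S - R * M * Rᴴ) *
        F (jacobiTransform (R * M * Rᴴ) (S - R * M * Rᴴ)) =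
      ENNReal.ofReal (‖R.det‖ ^ (2 * k)) * ENNReal.ofReal (‖R.det‖ ^ (2 * l)) *
        (detPowOnCone k M * detPowOnCone l (1 - M) * F M) := fun M => by
    have h1 : S - R * M * Rᴴ = R * (1 - M) * Rᴴ := by
      rw [Matrix.mul_sub, Matrix.sub_mul, Matrix.mul_one, hRH, hRR]
    have h2 : jacobiTransform (R * M * Rᴴ) (S - R * M * Rᴴ) = M := by
      rw [jacobiTransform, add_sub_cancel, ← hR, hRH, Matrix.mul_assoc, Matrix.mul_assoc,
        Matrix.mul_assoc, Matrix.mul_nonsing_inv _ hRu, Matrix.mul_one, ← Matrix.mul_assoc,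
        Matrix.nonsing_inv_mul _ hRu, Matrix.one_mul]
    rw [h2, h1, detPowOnCone_congruence hRu, detPowOnCone_congruence hRu]
    ring
  simp only [hpt]
  rw [lintegral_const_mul _ hm', ← mul_assoc, ← ENNReal.ofReal_mul (by positivity),
    ← ENNReal.ofReal_mul (by positivity)]
  congr 2
  ring

/-- For `q ≤ r, s` and any weight `G` of the sum `AA* + BB*`, the law of `J(AA*, BB*)` is
proportional to `det M^{r-q} det (1-M)^{s-q} dM` on `0 < M < 1`. -/
theorem exists_lintegral_jacobiTransform {q r s : ℕ} (hr : q ≤ r) (hs : q ≤ s)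
    {G : Matrix (Fin q) (Fin q) ℂ → ENNReal} (hG : Measurable G) :
    ∃ K : ENNReal, ∀ F : Matrix (Fin q) (Fin q) ℂ → ENNReal, Measurable F →
      ∫⁻ A, ∫⁻ B, F (jacobiTransform (A * Aᴴ) (B * Bᴴ)) * G (A * Aᴴ + B * Bᴴ)
          ∂(matrixLebesgue q s) ∂(matrixLebesgue q r) =
        K * ∫⁻ M, detPowOnCone (r - q) M * detPowOnCone (s - q) (1 - M) * F M
          ∂(hermitianLebesgue q) := by
  classical
  obtain ⟨C, hC⟩ := exists_lintegral_mul_conjTranspose_detPow hr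
  obtain ⟨C', hC'⟩ := exists_lintegral_mul_conjTranspose_detPow hs
  set H := hermitianLebesgue q with hH
  set w : Matrix (Fin q) (Fin q) ℂ → ENNReal := detPowOnCone (r - q) with hw
  set w' : Matrix (Fin q) (Fin q) ℂ → ENNReal := detPowOnCone (s - q) with hw'
  have hwm : Measurable w := measurable_detPowOnCone _
  have hwm' : Measurable w' := measurable_detPowOnCone _
  set κ : Matrix (Fin q) (Fin q) ℂ → ENNReal :=
    {S : Matrix (Fin q) (Fin q) ℂ | S.PosDef}.indicator fun S =>
      ENNReal.ofReal (‖(CFC.sqrt S).det‖ ^ (2 * (q + (r - q) + (s - q)))) with hκ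
  have hκm : Measurable κ :=
    ((measurable_det.comp measurable_matrix_sqrt).norm.pow_const _).ennreal_ofReal.indicator
      (measurableSet_posDef q)
  refine ⟨C * C' * ∫⁻ S, G S * κ S ∂H, fun F hF => ?_⟩
  set I := ∫⁻ M, w M * w' (1 - M) * F M ∂H
  set Φ : Matrix (Fin q) (Fin q) ℂ × Matrix (Fin q) (Fin q) ℂ → ENNReal :=
    fun x => F (jacobiTransform x.1 x.2) * G (x.1 + x.2) with hΦ
  have hΦm : Measurable Φ :=
    (hF.comp (measurable_fst.jacobiTransform measurable_snd)).mul
      (hG.comp (measurable_fst.add measurable_snd))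
  have hΨm : Measurable fun x : Matrix (Fin q) (Fin q) ℂ × Matrix (Fin q) (Fin q) ℂ =>
      w' x.2 * Φ x := (hwm'.comp measurable_snd).mul hΦm
  have hin : Measurable fun X => C' * ∫⁻ X', w' X' * Φ (X, X') ∂H :=
    hΨm.lintegral_prod_right'.const_mul C'
  calc ∫⁻ A, ∫⁻ B, Φ (A * Aᴴ, B * Bᴴ) ∂(matrixLebesgue q s) ∂(matrixLebesgue q r)
      = ∫⁻ A : Matrix (Fin q) (Fin r) ℂ, C' * ∫⁻ X', w' X' * Φ (A * Aᴴ, X') ∂H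
          ∂(matrixLebesgue q r) := by
        refine lintegral_congr fun A => ?_
        exact hC' (fun X' => Φ (A * Aᴴ, X')) (hΦm.comp measurable_prodMk_left)
    _ = C * ∫⁻ X, w X * (C' * ∫⁻ X', w' X' * Φ (X, X') ∂H) ∂H :=
        hC (fun X => C' * ∫⁻ X', w' X' * Φ (X, X') ∂H) hin
    _ = C * C' * ∫⁻ X, w X * ∫⁻ X', w' X' * Φ (X, X') ∂H ∂H := by
        have hm : Measurable fun X => w X * ∫⁻ X', w' X' * Φ (X, X') ∂H :=
          hwm.mul hΨm.lintegral_prod_right'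
        rw [mul_assoc, ← lintegral_const_mul _ hm]
        congr 1
        exact lintegral_congr fun X => by ring
    -- Substitute `X' = S - X`, by translation invariance.
    _ = C * C' * ∫⁻ X, ∫⁻ S, w X * (w' (S - X) * Φ (X, S - X)) ∂H ∂H := by
        congr 1
        refine lintegral_congr_ae ?_
        filter_upwards [ae_isHermitian_hermitianLebesgue q] with X hX
        have hm : Measurable fun X' => w' X' * Φ (X, X') := hΨm.comp measurable_prodMk_left
        have hm' : Measurable fun S => w' (S - X) * Φ (X, S - X) :=
          hm.comp (measurable_id.sub_const X)
        rw [lintegral_const_mul _ hm', lintegral_hermitianLebesgue_sub hX hm]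
    _ = C * C' * ∫⁻ S, ∫⁻ X, w X * (w' (S - X) * Φ (X, S - X)) ∂H ∂H := by
        congr 1
        refine lintegral_lintegral_swap (Measurable.aemeasurable ?_)
        exact (hwm.comp measurable_fst).mul (hΨm.comp
          (measurable_fst.prodMk (measurable_snd.sub measurable_fst)))
    _ = C * C' * ∫⁻ S, G S * κ S * I ∂H := by
        congr 1
        refine lintegral_congr fun S => ?_
        have hpt : ∀ X, w X * (w' (S - X) * Φ (X, S - X)) =
            G S * (w X * w' (S - X) * F (jacobiTransform X (S - X))) := fun X => by
          simp only [hΦ, add_sub_cancel]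
          ring
        have hsub : Measurable fun X : Matrix (Fin q) (Fin q) ℂ => S - X :=
          measurable_id.const_sub S
        have hm : Measurable fun X =>
            w X * w' (S - X) * F (jacobiTransform X (S - X)) :=
          (hwm.mul (hwm'.comp hsub)).mul
            (hF.comp (measurable_id.jacobiTransform hsub))
        simp only [hpt]
        rw [lintegral_const_mul _ hm, mul_assoc]
        congr 1
        by_cases hS : S.PosDef
        · rw [hκ, Set.indicator_of_mem (by exact hS)]
          exact lintegral_jacobiTransform_fixed_sum _ _ hS hF
        · rw [hκ, Set.indicator_of_notMem (by exact hS), zero_mul]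
          rw [← lintegral_zero (μ := H)]
          refine lintegral_congr fun X => ?_
          by_cases hX : X.PosDef
          · have : ¬ (S - X).PosDef := fun h => hS (by simpa using hX.add h)
            simp [hw', detPowOnCone_of_not_posDef this]
          · simp [hw, detPowOnCone_of_not_posDef hX]
    _ = C * C' * (∫⁻ S, G S * κ S ∂H) * I := by
        have hm : Measurable fun S => G S * κ S := hG.mul hκm
        rw [lintegral_mul_const _ hm, ← mul_assoc]

/-! ### Corner isometries and the uniform projection -/

/-- A self-adjoint projection of rank `q` is `V V*`, where the columns of `V` are the eigenvectors
with nonzero eigenvalue. -/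
theorem exists_isCornerIsometry {n q : ℕ} {p : Matrix (Fin n) (Fin n) ℂ} (hp : IsStarProjection p)
    (hpq : p.rank = q) : ∃ V : Matrix (Fin n) (Fin q) ℂ, IsCornerIsometry p V := by
  have hH : p.IsHermitian := hp.isSelfAdjoint
  set W : Matrix (Fin n) (Fin n) ℂ := (hH.eigenvectorUnitary : Matrix (Fin n) (Fin n) ℂ) with hW
  set l := hH.eigenvalues with hl
  have hWW : Wᴴ * W = 1 := by
    rw [← Matrix.star_eq_conjTranspose]; exact Unitary.coe_star_mul_self hH.eigenvectorUnitary
  have hWW' : W * Wᴴ = 1 := mul_eq_one_comm.mp hWW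
  have hspec : p = W * Matrix.diagonal (fun i => (l i : ℂ)) * Wᴴ := by
    conv_lhs => rw [hH.spectral_theorem]
    simp only [Unitary.conjStarAlgAut_apply, Matrix.star_eq_conjTranspose]
    rfl
  have hdiag : Matrix.diagonal (fun i => (l i : ℂ)) = Wᴴ * p * W := by
    rw [hspec]
    calc Matrix.diagonal (fun i => (l i : ℂ))
        = (Wᴴ * W) * Matrix.diagonal (fun i => (l i : ℂ)) * (Wᴴ * W) := by
          rw [hWW, Matrix.one_mul, Matrix.mul_one]
      _ = _ := by simp only [Matrix.mul_assoc]
  have hl01 : ∀ i, l i ≠ 0 → l i = 1 := fun i hi => by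
    have h1 : Matrix.diagonal (fun i => (l i : ℂ)) * Matrix.diagonal (fun i => (l i : ℂ)) =
        Matrix.diagonal (fun i => (l i : ℂ)) := by
      rw [hdiag]
      calc Wᴴ * p * W * (Wᴴ * p * W) = Wᴴ * p * (W * Wᴴ) * p * W := by
            simp only [Matrix.mul_assoc]
        _ = Wᴴ * (p * p) * W := by rw [hWW', Matrix.mul_one]; simp only [Matrix.mul_assoc]
        _ = Wᴴ * p * W := by rw [hp.isIdempotentElem.eq]
    rw [Matrix.diagonal_mul_diagonal] at h1
    have h2 := congrFun (Matrix.diagonal_injective h1) i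
    have h3 : l i * l i = l i := by exact_mod_cast h2
    exact mul_left_cancel₀ hi (by rw [h3, mul_one])
  have hcard : Fintype.card {i // l i ≠ 0} = q := by
    rw [← hpq, hH.rank_eq_card_non_zero_eigs]
  let e : Fin q ≃ {i // l i ≠ 0} := (Fintype.equivFinOfCardEq hcard).symm
  refine ⟨W.submatrix id fun k => (e k : Fin n), ?_, ?_⟩
  · have hinj : Function.Injective fun k => (e k : Fin n) :=
      Subtype.val_injective.comp e.injective
    calc (W.submatrix id fun k => (e k : Fin n))ᴴ * W.submatrix id (fun k => (e k : Fin n))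
        = (Wᴴ * W).submatrix (fun k => (e k : Fin n)) (fun k => (e k : Fin n)) := rfl
      _ = 1 := by rw [hWW, Matrix.submatrix_one _ hinj]
  · rw [hspec]
    ext i j
    have hR : (W * Matrix.diagonal (fun i => (l i : ℂ)) * Wᴴ) i j =
        ∑ k, W i k * l k * Wᴴ k j := by
      rw [Matrix.mul_apply]
      simp only [Matrix.mul_diagonal]
    rw [hR, Matrix.mul_apply]
    have h0 : ∑ k, W i k * l k * Wᴴ k j =
        ∑ k : {k // l k ≠ 0}, W i k * l k * Wᴴ k j := by
      rw [← Fintype.sum_subtype_add_sum_subtype (fun k => l k ≠ 0)]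
      refine add_eq_left.mpr (Finset.sum_eq_zero fun k _ => ?_)
      rw [not_not.mp k.2, Complex.ofReal_zero, mul_zero, zero_mul]
    rw [h0, ← e.sum_comp]
    refine Finset.sum_congr rfl fun k _ => ?_
    rw [hl01 _ (e k).2]
    simp [Matrix.conjTranspose_apply]

/-- The isometry `ℂ^q → ℂⁿ` onto the first `q` coordinates. -/
def coordIsometry {n q : ℕ} (hqn : q ≤ n) : Matrix (Fin n) (Fin q) ℂ :=
  Matrix.of fun i j => if i = Fin.castLE hqn j then 1 else 0

theorem mul_coordIsometry {n q : ℕ} (hqn : q ≤ n) (W : Matrix (Fin n) (Fin n) ℂ) :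
    W * coordIsometry hqn = W.submatrix id (Fin.castLE hqn) := by
  ext i j
  simp [coordIsometry, Matrix.mul_apply]

/-- The columns of an isometry `V` extend to an orthonormal basis. -/
theorem exists_unitary_mul_coordIsometry {n q : ℕ} (hqn : q ≤ n) {V : Matrix (Fin n) (Fin q) ℂ}
    (hV : Vᴴ * V = 1) :
    ∃ W : Matrix.unitaryGroup (Fin n) ℂ,
      V = (W : Matrix (Fin n) (Fin n) ℂ) * coordIsometry hqn := by
  let v : Fin n → EuclideanSpace ℂ (Fin n) := fun i =>
    if h : (i : ℕ) < q then WithLp.toLp 2 (fun k => V k ⟨i, h⟩) else 0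
  let S : Set (Fin n) := {i | (i : ℕ) < q}
  have hv : Orthonormal ℂ (S.domRestrict v) := by
    rw [orthonormal_iff_ite]
    rintro ⟨i, hi⟩ ⟨j, hj⟩
    have hi' : (i : ℕ) < q := hi
    have hj' : (j : ℕ) < q := hj
    have h1 := congrFun (congrFun hV ⟨i, hi'⟩) ⟨j, hj'⟩
    simp only [Set.domRestrict_apply, v, hi', hj', dif_pos]
    rw [EuclideanSpace.inner_eq_star_dotProduct]
    rw [Matrix.mul_apply] at h1
    simp only [Matrix.one_apply, Fin.mk.injEq, Matrix.conjTranspose_apply] at h1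
    simp only [dotProduct, Pi.star_apply, Subtype.mk.injEq, Fin.ext_iff]
    rw [← h1]
    exact Finset.sum_congr rfl fun k _ => mul_comm _ _
  obtain ⟨b, hb⟩ := hv.exists_orthonormalBasis_extension_of_card_eq (by simp)
  let W : Matrix (Fin n) (Fin n) ℂ := Matrix.of fun i j => b j i
  have hWu : W ∈ Matrix.unitaryGroup (Fin n) ℂ := by
    rw [Matrix.mem_unitaryGroup_iff']
    ext i j
    have h1 := orthonormal_iff_ite.mp b.orthonormal i j
    rw [EuclideanSpace.inner_eq_star_dotProduct] at h1
    rw [Matrix.star_eq_conjTranspose, Matrix.mul_apply, Matrix.one_apply, ← h1]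
    exact Finset.sum_congr rfl fun k _ => mul_comm _ _
  refine ⟨⟨W, hWu⟩, ?_⟩
  rw [mul_coordIsometry]
  ext i j
  have h1 := hb (Fin.castLE hqn j) j.2
  have h2 : v (Fin.castLE hqn j) = WithLp.toLp 2 (fun k => V k j) := by
    simp only [v]
    rw [dif_pos (show ((Fin.castLE hqn j : Fin n) : ℕ) < q from j.2)]
    rfl
  rw [h2] at h1
  change V i j = b (Fin.castLE hqn j) i
  rw [h1]

instance unitaryHaar_isHaarMeasure (n : ℕ) : (unitaryHaar n).IsHaarMeasure := by
  unfold unitaryHaar; infer_instance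

instance unitaryHaar_isProbabilityMeasure (n : ℕ) : IsProbabilityMeasure (unitaryHaar n) :=
  ⟨Measure.haarMeasure_self⟩

/-- All corners of size `q` of the uniform projection have the same law: by left invariance of Haar
measure, and since the unitary group acts transitively on isometries. -/
theorem lintegral_unitaryHaar_corner {n q : ℕ} (hqn : q ≤ n) (E : Matrix (Fin n) (Fin n) ℂ)
    {V V' : Matrix (Fin n) (Fin q) ℂ} (hV : Vᴴ * V = 1) (hV' : V'ᴴ * V' = 1)
    (F : Matrix (Fin q) (Fin q) ℂ → ENNReal) :
    ∫⁻ U : Matrix.unitaryGroup (Fin n) ℂ,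
        F (Vᴴ * ((U : Matrix (Fin n) (Fin n) ℂ) * E * (U : Matrix (Fin n) (Fin n) ℂ)ᴴ) * V)
        ∂(unitaryHaar n) =
      ∫⁻ U : Matrix.unitaryGroup (Fin n) ℂ,
        F (V'ᴴ * ((U : Matrix (Fin n) (Fin n) ℂ) * E * (U : Matrix (Fin n) (Fin n) ℂ)ᴴ) * V')
        ∂(unitaryHaar n) := by
  have key : ∀ {V : Matrix (Fin n) (Fin q) ℂ}, Vᴴ * V = 1 →
      ∫⁻ U : Matrix.unitaryGroup (Fin n) ℂ,
        F (Vᴴ * ((U : Matrix (Fin n) (Fin n) ℂ) * E * (U : Matrix (Fin n) (Fin n) ℂ)ᴴ) * V)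
        ∂(unitaryHaar n) =
      ∫⁻ U : Matrix.unitaryGroup (Fin n) ℂ,
        F ((coordIsometry hqn)ᴴ * ((U : Matrix (Fin n) (Fin n) ℂ) * E *
          (U : Matrix (Fin n) (Fin n) ℂ)ᴴ) * coordIsometry hqn) ∂(unitaryHaar n) := by
    intro V hV
    obtain ⟨W, rfl⟩ := exists_unitary_mul_coordIsometry hqn hV
    conv_rhs => rw [← lintegral_mul_left_eq_self _ W⁻¹]
    refine lintegral_congr fun U => ?_
    congr 1
    have hW : ((W⁻¹ * U : Matrix.unitaryGroup (Fin n) ℂ) : Matrix (Fin n) (Fin n) ℂ) =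
        (W : Matrix (Fin n) (Fin n) ℂ)ᴴ * U := rfl
    rw [hW]
    simp only [Matrix.conjTranspose_mul, Matrix.conjTranspose_conjTranspose, Matrix.mul_assoc]
  rw [key hV, key hV']

/-! ### Side-by-side concatenation of Gaussian matrices -/

/-- The matrix `[A | B]`. -/
def concatCols {q r s : ℕ} (A : Matrix (Fin q) (Fin r) ℂ) (B : Matrix (Fin q) (Fin s) ℂ) :
    Matrix (Fin q) (Fin (r + s)) ℂ :=
  Matrix.of fun i => Fin.append (A i) (B i)

theorem concatCols_mul_conjTranspose {q r s : ℕ} (A : Matrix (Fin q) (Fin r) ℂ)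
    (B : Matrix (Fin q) (Fin s) ℂ) :
    concatCols A B * (concatCols A B)ᴴ = A * Aᴴ + B * Bᴴ := by
  ext i j
  simp [concatCols, Matrix.mul_apply, Fin.sum_univ_add]

theorem concatCols_mul_coordProjection {q r s : ℕ} (A : Matrix (Fin q) (Fin r) ℂ)
    (B : Matrix (Fin q) (Fin s) ℂ) :
    concatCols A B * coordProjection (r + s) r * (concatCols A B)ᴴ = A * Aᴴ := by
  ext i j
  simp [concatCols, coordProjection, Matrix.mul_apply, Fin.sum_univ_add, Matrix.diagonal_apply]

/-- Concatenation of columns, as a linear equivalence. -/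
noncomputable def concatColsEquiv (q r s : ℕ) :
    ((Fin q → Fin r → ℂ) × (Fin q → Fin s → ℂ)) ≃L[ℝ] (Fin q → Fin (r + s) → ℂ) :=
  LinearEquiv.toContinuousLinearEquiv
    { toFun := fun x i => Fin.append (x.1 i) (x.2 i)
      invFun := fun G => (fun i j => G i (Fin.castAdd s j), fun i j => G i (Fin.natAdd r j))
      map_add' := fun x y => by
        funext i k
        refine Fin.addCases (fun k => ?_) (fun k => ?_) k <;> simp
      map_smul' := fun c x => by
        funext i k
        refine Fin.addCases (fun k => ?_) (fun k => ?_) k <;> simp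
      left_inv := fun x => by simp
      right_inv := fun G => by
        funext i k
        refine Fin.addCases (fun k => ?_) (fun k => ?_) k <;> simp }

/-- Concatenation of columns maps the product of Lebesgue measures to a multiple of Lebesgue
measure, by uniqueness of Haar measure. -/
theorem exists_map_concatCols (q r s : ℕ) :
    ∃ c : ENNReal, ((matrixLebesgue q r).prod (matrixLebesgue q s)).map
      (fun x => concatCols x.1 x.2) = c • matrixLebesgue q (r + s) := by
  let μ : Measure ((Fin q → Fin r → ℂ) × (Fin q → Fin s → ℂ)) :=
    (volume : Measure (Fin q → Fin r → ℂ)).prod (volume : Measure (Fin q → Fin s → ℂ))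
  have hμ : μ.IsAddHaarMeasure := Measure.prod.instIsAddHaarMeasure _ _
  have h : (μ.map (concatColsEquiv q r s)).IsAddHaarMeasure :=
    ContinuousLinearEquiv.isAddHaarMeasure_map (concatColsEquiv q r s) μ
  refine ⟨Measure.addHaarScalarFactor (μ.map (concatColsEquiv q r s))
    (volume : Measure (Fin q → Fin (r + s) → ℂ)), ?_⟩
  exact Measure.isAddLeftInvariant_eq_smul (μ.map (concatColsEquiv q r s)) volume

theorem measurable_concatCols (q r s : ℕ) :
    Measurable fun x : Matrix (Fin q) (Fin r) ℂ × Matrix (Fin q) (Fin s) ℂ =>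
      concatCols x.1 x.2 :=
  (concatColsEquiv q r s).continuous.measurable

theorem exists_lintegral_concatCols (q r s : ℕ) :
    ∃ c : ENNReal, ∀ f : Matrix (Fin q) (Fin (r + s)) ℂ → ENNReal, Measurable f →
      ∫⁻ A, ∫⁻ B, f (concatCols A B) ∂(matrixLebesgue q s) ∂(matrixLebesgue q r) =
        c * ∫⁻ G, f G ∂(matrixLebesgue q (r + s)) := by
  obtain ⟨c, hc⟩ := exists_map_concatCols q r s
  refine ⟨c, fun f hf => ?_⟩
  have hm := measurable_concatCols q r s
  have hfm : Measurable fun x : Matrix (Fin q) (Fin r) ℂ × Matrix (Fin q) (Fin s) ℂ =>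
      f (concatCols x.1 x.2) := hf.comp hm
  rw [← smul_eq_mul, ← lintegral_smul_measure, ← hc, lintegral_map hf hm,
    lintegral_prod _ hfm.aemeasurable]

/-! ### Polar decomposition of a Gaussian matrix -/

/-- The compression `(G G*)^{-1/2} G E G* (G G*)^{-1/2}` of `E` by the coisometry
`(G G*)^{-1/2} G`. -/
noncomputable def polarCompression {q n : ℕ} (E : Matrix (Fin n) (Fin n) ℂ)
    (G : Matrix (Fin q) (Fin n) ℂ) : Matrix (Fin q) (Fin q) ℂ :=
  (CFC.sqrt (G * Gᴴ))⁻¹ * (G * E * Gᴴ) * (CFC.sqrt (G * Gᴴ))⁻¹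

theorem measurable_polarCompression {q n : ℕ} (E : Matrix (Fin n) (Fin n) ℂ) :
    Measurable (polarCompression (q := q) E) := by
  have h : Measurable fun G : Matrix (Fin q) (Fin n) ℂ => (CFC.sqrt (G * Gᴴ))⁻¹ :=
    measurable_matrix_inv.comp (measurable_matrix_sqrt.comp measurable_mul_conjTranspose)
  have h' : Measurable fun G : Matrix (Fin q) (Fin n) ℂ => G * E * Gᴴ :=
    ((continuous_id.matrix_mul continuous_const).matrix_mul
      continuous_id.matrix_conjTranspose).measurable
  exact (h.mul h').mul h

theorem polarCompression_concatCols {q r s : ℕ} (A : Matrix (Fin q) (Fin r) ℂ)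
    (B : Matrix (Fin q) (Fin s) ℂ) :
    polarCompression (coordProjection (r + s) r) (concatCols A B) =
      jacobiTransform (A * Aᴴ) (B * Bᴴ) := by
  rw [polarCompression, jacobiTransform, concatCols_mul_conjTranspose,
    concatCols_mul_coordProjection]

/-- For `G` of full rank, compressing by `G U` amounts to taking a corner of `U E U*`. -/
theorem polarCompression_mul_unitary {q n : ℕ} (E : Matrix (Fin n) (Fin n) ℂ)
    {G : Matrix (Fin q) (Fin n) ℂ} (hG : (G * Gᴴ).PosDef) :
    ∃ V : Matrix (Fin n) (Fin q) ℂ, Vᴴ * V = 1 ∧ ∀ U : Matrix.unitaryGroup (Fin n) ℂ,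
      polarCompression E (G * (U : Matrix (Fin n) (Fin n) ℂ)) =
        Vᴴ * ((U : Matrix (Fin n) (Fin n) ℂ) * E * (U : Matrix (Fin n) (Fin n) ℂ)ᴴ) * V := by
  set R := CFC.sqrt (G * Gᴴ) with hR
  have hRu : IsUnit R.det := isUnit_det_sqrt hG
  have hRH : Rᴴ = R := conjTranspose_sqrt _
  have hRR : R * R = G * Gᴴ := CFC.sqrt_mul_sqrt_self _ hG.posSemidef.nonneg
  have hRiH : (R⁻¹)ᴴ = R⁻¹ := by rw [Matrix.conjTranspose_nonsing_inv, hRH]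
  refine ⟨Gᴴ * R⁻¹, ?_, fun U => ?_⟩
  · rw [Matrix.conjTranspose_mul, hRiH, Matrix.conjTranspose_conjTranspose]
    calc R⁻¹ * G * (Gᴴ * R⁻¹) = R⁻¹ * (G * Gᴴ) * R⁻¹ := by simp only [Matrix.mul_assoc]
      _ = (R⁻¹ * R) * (R * R⁻¹) := by rw [← hRR]; simp only [Matrix.mul_assoc]
      _ = 1 := by
        rw [Matrix.nonsing_inv_mul _ hRu, Matrix.mul_nonsing_inv _ hRu, Matrix.mul_one]
  · have hUU : (U : Matrix (Fin n) (Fin n) ℂ) * (U : Matrix (Fin n) (Fin n) ℂ)ᴴ = 1 :=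
      Matrix.mem_unitaryGroup_iff.mp U.2
    have h1 : G * (U : Matrix (Fin n) (Fin n) ℂ) * (G * (U : Matrix (Fin n) (Fin n) ℂ))ᴴ =
        G * Gᴴ := by
      rw [Matrix.conjTranspose_mul, Matrix.mul_assoc,
        ← Matrix.mul_assoc (U : Matrix (Fin n) (Fin n) ℂ), hUU,
        Matrix.one_mul]
    rw [polarCompression, h1, ← hR, Matrix.conjTranspose_mul, Matrix.conjTranspose_mul, hRiH,
      Matrix.conjTranspose_conjTranspose]
    simp only [Matrix.mul_assoc]

/-- A unitarily invariant integral of the polar compression is an average over corners of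
`U E U*`. -/
theorem lintegral_polarCompression {q n : ℕ} (hqn : q ≤ n) (E : Matrix (Fin n) (Fin n) ℂ)
    {V : Matrix (Fin n) (Fin q) ℂ} (hV : Vᴴ * V = 1)
    {F w : Matrix (Fin q) (Fin q) ℂ → ENNReal} (hF : Measurable F) (hw : Measurable w) :
    ∫⁻ G, F (polarCompression E G) * w (G * Gᴴ) ∂(matrixLebesgue q n) =
      (∫⁻ U : Matrix.unitaryGroup (Fin n) ℂ,
        F (Vᴴ * ((U : Matrix (Fin n) (Fin n) ℂ) * E * (U : Matrix (Fin n) (Fin n) ℂ)ᴴ) * V)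
        ∂(unitaryHaar n)) * ∫⁻ G, w (G * Gᴴ) ∂(matrixLebesgue q n) := by
  have hFm : Measurable fun G : Matrix (Fin q) (Fin n) ℂ => F (polarCompression E G) :=
    hF.comp (measurable_polarCompression E)
  have hwm : Measurable fun G : Matrix (Fin q) (Fin n) ℂ => w (G * Gᴴ) :=
    hw.comp measurable_mul_conjTranspose
  have hm := hFm.mul hwm
  have hGU : Measurable fun x : Matrix.unitaryGroup (Fin n) ℂ × Matrix (Fin q) (Fin n) ℂ =>
      x.2 * (x.1 : Matrix (Fin n) (Fin n) ℂ) :=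
    (continuous_snd.matrix_mul (continuous_subtype_val.comp continuous_fst)).measurable
  have hwU : ∀ (U : Matrix.unitaryGroup (Fin n) ℂ) (G : Matrix (Fin q) (Fin n) ℂ),
      G * (U : Matrix (Fin n) (Fin n) ℂ) * (G * (U : Matrix (Fin n) (Fin n) ℂ))ᴴ = G * Gᴴ := by
    intro U G
    rw [Matrix.conjTranspose_mul, Matrix.mul_assoc,
      ← Matrix.mul_assoc (U : Matrix (Fin n) (Fin n) ℂ), ← Matrix.star_eq_conjTranspose,
      Matrix.mem_unitaryGroup_iff.mp U.2, Matrix.one_mul]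
  calc ∫⁻ G, F (polarCompression E G) * w (G * Gᴴ) ∂(matrixLebesgue q n)
      = ∫⁻ _ : Matrix.unitaryGroup (Fin n) ℂ,
          ∫⁻ G, F (polarCompression E G) * w (G * Gᴴ) ∂(matrixLebesgue q n)
          ∂(unitaryHaar n) := by simp
    _ = ∫⁻ U : Matrix.unitaryGroup (Fin n) ℂ,
          ∫⁻ G, F (polarCompression E (G * (U : Matrix (Fin n) (Fin n) ℂ))) * w (G * Gᴴ)
            ∂(matrixLebesgue q n) ∂(unitaryHaar n) := by
        refine lintegral_congr fun U => ?_
        refine (lintegral_matrixLebesgue_mul_unitary U.2 hm).symm.trans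
          (lintegral_congr fun G => ?_)
        simp only [Pi.mul_apply, hwU U G]
    _ = ∫⁻ G, ∫⁻ U : Matrix.unitaryGroup (Fin n) ℂ,
          F (polarCompression E (G * (U : Matrix (Fin n) (Fin n) ℂ))) * w (G * Gᴴ)
            ∂(unitaryHaar n) ∂(matrixLebesgue q n) := by
        refine lintegral_lintegral_swap (Measurable.aemeasurable ?_)
        exact (hFm.comp hGU).mul (hwm.comp measurable_snd)
    _ = ∫⁻ G, (∫⁻ U : Matrix.unitaryGroup (Fin n) ℂ,
          F (Vᴴ * ((U : Matrix (Fin n) (Fin n) ℂ) * E * (U : Matrix (Fin n) (Fin n) ℂ)ᴴ) * V)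
          ∂(unitaryHaar n)) * w (G * Gᴴ) ∂(matrixLebesgue q n) := by
        refine lintegral_congr_ae ?_
        filter_upwards [ae_posDef_mul_conjTranspose hqn] with G hG
        have hFU : Measurable fun U : Matrix.unitaryGroup (Fin n) ℂ =>
            F (polarCompression E (G * (U : Matrix (Fin n) (Fin n) ℂ))) :=
          hFm.comp (hGU.comp measurable_prodMk_right)
        rw [lintegral_mul_const _ hFU]
        obtain ⟨V', hV', hU⟩ := polarCompression_mul_unitary E hG
        simp only [hU]
        rw [lintegral_unitaryHaar_corner hqn E hV' hV]
    _ = _ := lintegral_const_mul _ hwm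

/-! ### Laws of the random matrices -/

/-- The Gaussian weight as a function of `A A*`. -/
noncomputable def gaussianWeight (q : ℕ) (a : ℝ) (X : Matrix (Fin q) (Fin q) ℂ) : ENNReal :=
  ENNReal.ofReal (Real.exp (-(a⁻¹ * X.trace.re)))

theorem measurable_gaussianWeight (q : ℕ) (a : ℝ) : Measurable (gaussianWeight q a) := by
  have h : Continuous fun X : Matrix (Fin q) (Fin q) ℂ => X.trace.re :=
    Complex.continuous_re.comp continuous_id.matrix_trace
  exact ((h.measurable.const_mul _).neg.exp).ennreal_ofReal

theorem gaussianWeight_add (q : ℕ) (a : ℝ) (X Y : Matrix (Fin q) (Fin q) ℂ) :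
    gaussianWeight q a (X + Y) = gaussianWeight q a X * gaussianWeight q a Y := by
  rw [gaussianWeight, gaussianWeight, gaussianWeight, ← ENNReal.ofReal_mul (Real.exp_pos _).le,
    ← Real.exp_add, Matrix.trace_add, Complex.add_re]
  congr 2
  ring

theorem exists_lintegral_wishart (q p : ℕ) (a : ℝ) :
    ∃ N : ENNReal, ∀ f : Matrix (Fin q) (Fin q) ℂ → ENNReal, Measurable f →
      ∫⁻ X, f X ∂(wishart q p a) =
        N * ∫⁻ A, gaussianWeight q a (A * Aᴴ) * f (A * Aᴴ) ∂(matrixLebesgue q p) := by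
  refine ⟨((matrixLebesgue q p).withDensity (fun A =>
    ENNReal.ofReal (Real.exp (-(a⁻¹ * (A * Aᴴ).trace.re)))) Set.univ)⁻¹, fun f hf => ?_⟩
  have hm := measurable_mul_conjTranspose (q := q) (p := p)
  have hfm : Measurable fun A : Matrix (Fin q) (Fin p) ℂ => f (A * Aᴴ) := hf.comp hm
  have hw : Measurable fun A : Matrix (Fin q) (Fin p) ℂ =>
      ENNReal.ofReal (Real.exp (-(a⁻¹ * (A * Aᴴ).trace.re))) :=
    (measurable_gaussianWeight q a).comp hm
  rw [wishart, lintegral_map hf hm, gaussianMatrix, normalizedMeasure, lintegral_smul_measure,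
    lintegral_withDensity_eq_lintegral_mul _ hw hfm]
  rfl

/-- The joint law of two independent Wishart matrices, up to normalization. -/
theorem exists_lintegral_wishart_pair {q r s : ℕ} {a : ℝ} {Ω : Type*} [MeasurableSpace Ω]
    {P : Measure Ω} [IsProbabilityMeasure P] {X X' : Ω → Matrix (Fin q) (Fin q) ℂ}
    (hX : HasLaw X (wishart q r a) P) (hX' : HasLaw X' (wishart q s a) P)
    (hXX' : IndepFun X X' P) :
    ∃ N : ENNReal, ∀ f : Matrix (Fin q) (Fin q) ℂ × Matrix (Fin q) (Fin q) ℂ → ENNReal,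
      Measurable f → ∫⁻ ω, f (X ω, X' ω) ∂P =
        N * ∫⁻ A, ∫⁻ B, f (A * Aᴴ, B * Bᴴ) * gaussianWeight q a (A * Aᴴ + B * Bᴴ)
          ∂(matrixLebesgue q s) ∂(matrixLebesgue q r) := by
  obtain ⟨N, hN⟩ := exists_lintegral_wishart q r a
  obtain ⟨N', hN'⟩ := exists_lintegral_wishart q s a
  have hpr : IsProbabilityMeasure (wishart q r a) := by
    rw [← hX.map_eq]; exact Measure.isProbabilityMeasure_map hX.aemeasurable
  have hpr' : IsProbabilityMeasure (wishart q s a) := by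
    rw [← hX'.map_eq]; exact Measure.isProbabilityMeasure_map hX'.aemeasurable
  have hlaw : P.map (fun ω => (X ω, X' ω)) = (wishart q r a).prod (wishart q s a) := by
    rw [(indepFun_iff_map_prod_eq_prod_map_map hX.aemeasurable hX'.aemeasurable).mp hXX',
      hX.map_eq, hX'.map_eq]
  refine ⟨N * N', fun f hf => ?_⟩
  have hg := measurable_gaussianWeight q a
  have hin : Measurable fun x : Matrix (Fin q) (Fin q) ℂ × Matrix (Fin q) (Fin s) ℂ =>
      gaussianWeight q a (x.2 * x.2ᴴ) * f (x.1, x.2 * x.2ᴴ) :=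
    (hg.comp (measurable_mul_conjTranspose.comp measurable_snd)).mul
      (hf.comp (measurable_fst.prodMk (measurable_mul_conjTranspose.comp measurable_snd)))
  have hinA : ∀ A : Matrix (Fin q) (Fin r) ℂ, Measurable fun B : Matrix (Fin q) (Fin s) ℂ =>
      gaussianWeight q a (B * Bᴴ) * f (A * Aᴴ, B * Bᴴ) := fun A =>
    (hg.comp measurable_mul_conjTranspose).mul
      (hf.comp (measurable_const.prodMk measurable_mul_conjTranspose))
  calc ∫⁻ ω, f (X ω, X' ω) ∂P
      = ∫⁻ x, f x ∂((wishart q r a).prod (wishart q s a)) := by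
        rw [← hlaw, lintegral_map' hf.aemeasurable (hX.aemeasurable.prodMk hX'.aemeasurable)]
    _ = ∫⁻ x, ∫⁻ y, f (x, y) ∂(wishart q s a) ∂(wishart q r a) := lintegral_prod _ hf.aemeasurable
    _ = ∫⁻ x, N' * ∫⁻ B, gaussianWeight q a (B * Bᴴ) * f (x, B * Bᴴ) ∂(matrixLebesgue q s)
          ∂(wishart q r a) :=
        lintegral_congr fun x => hN' _ (hf.comp measurable_prodMk_left)
    _ = N' * (N * ∫⁻ A, gaussianWeight q a (A * Aᴴ) * ∫⁻ B, gaussianWeight q a (B * Bᴴ) *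
          f (A * Aᴴ, B * Bᴴ) ∂(matrixLebesgue q s) ∂(matrixLebesgue q r)) := by
        rw [lintegral_const_mul _ hin.lintegral_prod_right', hN _ hin.lintegral_prod_right']
    _ = _ := by
        rw [← mul_assoc, mul_comm N']
        congr 1
        refine lintegral_congr fun A => ?_
        rw [← lintegral_const_mul _ (hinA A)]
        refine lintegral_congr fun B => ?_
        rw [gaussianWeight_add]
        ring

theorem lintegral_uniformProjection_corner {n r q : ℕ} {p : Matrix (Fin n) (Fin n) ℂ}
    {Ω : Type*} [MeasurableSpace Ω] {P : Measure Ω} {Q : Ω → Matrix (Fin n) (Fin n) ℂ}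
    (hQ : HasLaw Q (uniformProjection n r) P) {V : Matrix (Fin n) (Fin q) ℂ}
    (hV : IsCornerIsometry p V) {F : Matrix (Fin q) (Fin q) ℂ → ENNReal} (hF : Measurable F) :
    ∫⁻ ω, F (Vᴴ * (p * Q ω * p) * V) ∂P =
      ∫⁻ U : Matrix.unitaryGroup (Fin n) ℂ, F (Vᴴ * ((U : Matrix (Fin n) (Fin n) ℂ) *
        coordProjection n r * (U : Matrix (Fin n) (Fin n) ℂ)ᴴ) * V) ∂(unitaryHaar n) := by
  have hpV : p * V = V := by rw [← hV.2, Matrix.mul_assoc, hV.1, Matrix.mul_one]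
  have hVp : Vᴴ * p = Vᴴ := by rw [← hV.2, ← Matrix.mul_assoc, hV.1, Matrix.one_mul]
  have hcorner : ∀ M : Matrix (Fin n) (Fin n) ℂ, Vᴴ * (p * M * p) * V = Vᴴ * M * V := fun M => by
    calc Vᴴ * (p * M * p) * V = (Vᴴ * p) * M * (p * V) := by simp only [Matrix.mul_assoc]
      _ = _ := by rw [hpV, hVp]
  have hm : Measurable fun M : Matrix (Fin n) (Fin n) ℂ => Vᴴ * M * V :=
    ((continuous_const.matrix_mul continuous_id).matrix_mul continuous_const).measurable
  have hU : Measurable fun U : Matrix.unitaryGroup (Fin n) ℂ =>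
      (U : Matrix (Fin n) (Fin n) ℂ) * coordProjection n r * (U : Matrix (Fin n) (Fin n) ℂ)ᴴ :=
    ((continuous_subtype_val.matrix_mul continuous_const).matrix_mul
      continuous_subtype_val.matrix_conjTranspose).measurable
  have hFm : Measurable fun M : Matrix (Fin n) (Fin n) ℂ => F (Vᴴ * M * V) := hF.comp hm
  simp only [hcorner]
  rw [← lintegral_map' (f := fun M => F (Vᴴ * M * V)) hFm.aemeasurable hQ.aemeasurable, hQ.map_eq,
    uniformProjection, lintegral_map hFm hU]

/-- The density of the Jacobi unitary ensemble agrees almost everywhere with the product of the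
truncated powers of `det M` and `det (1 - M)`. -/
theorem jacobiUnitaryEnsemble_eq {q : ℕ} (k l : ℕ) :
    jacobiUnitaryEnsemble q l k = normalizedMeasure ((hermitianLebesgue q).withDensity fun M =>
      detPowOnCone k M * detPowOnCone l (1 - M)) := by
  have hsing : ∀ᵐ M ∂(hermitianLebesgue q), (1 - M).det ≠ 0 := by
    have hs : MeasurableSet {M : Matrix (Fin q) (Fin q) ℂ | M.det = 0} :=
      measurable_det (MeasurableSet.singleton 0)
    have hs' : MeasurableSet {M : Matrix (Fin q) (Fin q) ℂ | (M - 1).det = 0} :=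
      (measurable_id.sub_const (1 : Matrix (Fin q) (Fin q) ℂ)) hs
    have h0 : hermitianLebesgue q {M | M.det = 0} = 0 := by
      have := ae_iff.mp (ae_det_ne_zero_hermitianLebesgue q)
      simpa using this
    have h1 := lintegral_hermitianLebesgue_sub (q := q) Matrix.isHermitian_one
      (f := {M : Matrix (Fin q) (Fin q) ℂ | M.det = 0}.indicator 1) (measurable_one.indicator hs)
    rw [lintegral_indicator_one hs, h0] at h1
    have h2 : hermitianLebesgue q {M | (M - 1).det = 0} = 0 := by
      rw [← lintegral_indicator_one hs', ← h1]
      rfl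
    rw [ae_iff]
    refine measure_mono_null (fun M hM => ?_) h2
    have hM' : (1 - M).det = 0 := not_not.mp hM
    rw [← neg_sub, Matrix.det_neg] at hM'
    exact (mul_eq_zero.mp hM').resolve_left (pow_ne_zero _ (by simp))
  -- The two densities differ only where `M` or `1 - M` is singular: there `0 ^ 0 = 1` may occur.
  rw [jacobiUnitaryEnsemble]
  congr 1
  refine withDensity_congr_ae ?_
  filter_upwards [hsing, ae_det_ne_zero_hermitianLebesgue q] with M h1 h0
  split_ifs with h
  · have hM : M.PosDef := h.1.posDef_iff_det_ne_zero.mpr h0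
    have hM' : (1 - M).PosDef := h.2.posDef_iff_det_ne_zero.mpr h1
    rw [detPowOnCone_of_posDef hM, detPowOnCone_of_posDef hM', Real.rpow_natCast,
      Real.rpow_natCast, mul_comm, ENNReal.ofReal_mul (pow_nonneg hM.det_re_pos.le _)]
  · by_cases hM : M.PosDef
    · have hM' : ¬ (1 - M).PosDef := fun h' => h ⟨hM.posSemidef, h'.posSemidef⟩
      rw [detPowOnCone_of_not_posDef hM', mul_zero]
    · rw [detPowOnCone_of_not_posDef hM, zero_mul]

/-! ### Comparison of the laws -/

/-- A probability measure that integrates functions like `K • μ` is the normalization of `μ`. -/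
theorem eq_normalizedMeasure_of_lintegral {S : Type*} [MeasurableSpace S] {ν μ : Measure S}
    [IsProbabilityMeasure ν] {K : ENNReal}
    (h : ∀ f : S → ENNReal, Measurable f → ∫⁻ x, f x ∂ν = K * ∫⁻ x, f x ∂μ) :
    ν = normalizedMeasure μ := by
  have h1 := h 1 measurable_one
  simp only [Pi.one_apply, lintegral_one, measure_univ] at h1
  rw [normalizedMeasure, ← ENNReal.eq_inv_of_mul_eq_one_left h1.symm]
  ext s hs
  have h2 := h (s.indicator 1) (measurable_one.indicator hs)
  rw [lintegral_indicator_one hs, lintegral_indicator_one hs] at h2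
  rw [h2, Measure.smul_apply, smul_eq_mul]

/-- The sum of two independent Wishart matrices with at least `q` columns in total is almost surely
positive definite. -/
theorem ae_posDef_add_of_wishart {q r s : ℕ} {a : ℝ} (hq : q ≤ r + s) {Ω : Type*}
    [MeasurableSpace Ω] {P : Measure Ω} [IsProbabilityMeasure P]
    {X X' : Ω → Matrix (Fin q) (Fin q) ℂ} (hX : HasLaw X (wishart q r a) P)
    (hX' : HasLaw X' (wishart q s a) P) (hXX' : IndepFun X X' P) :
    ∀ᵐ ω ∂P, (X ω + X' ω).PosDef := by
  classical
  obtain ⟨N, hN⟩ := exists_lintegral_wishart_pair hX hX' hXX'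
  obtain ⟨c, hc⟩ := exists_lintegral_concatCols q r s
  have hs : MeasurableSet {Y : Matrix (Fin q) (Fin q) ℂ | ¬ Y.PosDef} :=
    (measurableSet_posDef q).compl
  set φ : Matrix (Fin q) (Fin q) ℂ → ENNReal :=
    {Y : Matrix (Fin q) (Fin q) ℂ | ¬ Y.PosDef}.indicator 1 with hφ
  have hφm : Measurable φ := measurable_one.indicator hs
  have hgm : Measurable fun G : Matrix (Fin q) (Fin (r + s)) ℂ =>
      φ (G * Gᴴ) * gaussianWeight q a (G * Gᴴ) :=
    (hφm.mul (measurable_gaussianWeight q a)).comp measurable_mul_conjTranspose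
  have h1 := hN (fun x => φ (x.1 + x.2)) (hφm.comp (measurable_fst.add measurable_snd))
  have h2 := hc _ hgm
  simp only [concatCols_mul_conjTranspose] at h2
  have h3 : ∫⁻ G, φ (G * Gᴴ) * gaussianWeight q a (G * Gᴴ) ∂(matrixLebesgue q (r + s)) = 0 := by
    refine (lintegral_congr_ae ?_).trans lintegral_zero
    filter_upwards [ae_posDef_mul_conjTranspose hq] with G hG
    simp [hφ, hG]
  rw [h2, h3, mul_zero, mul_zero] at h1
  have hsum : AEMeasurable (fun ω => φ (X ω + X' ω)) P :=
    hφm.comp_aemeasurable (hX.aemeasurable.add hX'.aemeasurable)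
  filter_upwards [(lintegral_eq_zero_iff' hsum).mp h1] with ω hω
  by_contra hn
  simp [hφ, hn] at hω

/-- The matrix `J` of two independent Wishart matrices has the law of the corner of the uniform
projection cut out by any isometry `V`. -/
theorem lintegral_jacobiTransform_wishart {q r s : ℕ} {a : ℝ} (hq : q ≤ r + s) {Ω : Type*}
    [MeasurableSpace Ω] {P : Measure Ω} [IsProbabilityMeasure P]
    {X X' : Ω → Matrix (Fin q) (Fin q) ℂ} (hX : HasLaw X (wishart q r a) P)
    (hX' : HasLaw X' (wishart q s a) P) (hXX' : IndepFun X X' P)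
    {V : Matrix (Fin (r + s)) (Fin q) ℂ} (hV : Vᴴ * V = 1)
    {F : Matrix (Fin q) (Fin q) ℂ → ENNReal} (hF : Measurable F) :
    ∫⁻ ω, F (jacobiTransform (X ω) (X' ω)) ∂P =
      ∫⁻ U : Matrix.unitaryGroup (Fin (r + s)) ℂ,
        F (Vᴴ * ((U : Matrix (Fin (r + s)) (Fin (r + s)) ℂ) * coordProjection (r + s) r *
          (U : Matrix (Fin (r + s)) (Fin (r + s)) ℂ)ᴴ) * V) ∂(unitaryHaar (r + s)) := by
  obtain ⟨N, hN⟩ := exists_lintegral_wishart_pair hX hX' hXX'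
  obtain ⟨c, hc⟩ := exists_lintegral_concatCols q r s
  have hw := measurable_gaussianWeight q a
  have key : ∀ F : Matrix (Fin q) (Fin q) ℂ → ENNReal, Measurable F →
      ∫⁻ ω, F (jacobiTransform (X ω) (X' ω)) ∂P =
        (∫⁻ U : Matrix.unitaryGroup (Fin (r + s)) ℂ,
          F (Vᴴ * ((U : Matrix (Fin (r + s)) (Fin (r + s)) ℂ) * coordProjection (r + s) r *
            (U : Matrix (Fin (r + s)) (Fin (r + s)) ℂ)ᴴ) * V) ∂(unitaryHaar (r + s))) *
        (N * (c * ∫⁻ G, gaussianWeight q a (G * Gᴴ) ∂(matrixLebesgue q (r + s)))) := by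
    intro F hF
    have h1 := hN (fun x => F (jacobiTransform x.1 x.2))
      (hF.comp (measurable_fst.jacobiTransform measurable_snd))
    have hm : Measurable fun G : Matrix (Fin q) (Fin (r + s)) ℂ =>
        F (polarCompression (coordProjection (r + s) r) G) * gaussianWeight q a (G * Gᴴ) :=
      (hF.comp (measurable_polarCompression _)).mul (hw.comp measurable_mul_conjTranspose)
    have h2 := hc _ hm
    simp only [concatCols_mul_conjTranspose, polarCompression_concatCols] at h2
    rw [h1, h2, lintegral_polarCompression hq _ hV hF hw]
    ring
  -- The case `F = 1` shows that the normalizing constant is `1`.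
  have hone := key 1 measurable_one
  simp only [Pi.one_apply, lintegral_one, measure_univ, one_mul] at hone
  rw [key F hF, ← hone, mul_one]

/-- For `q ≤ r, s`, the matrix `J` of two independent Wishart matrices has the law of the Jacobi
unitary ensemble. -/
theorem map_jacobiTransform_wishart {q r s : ℕ} {a : ℝ} (hr : q ≤ r) (hs : q ≤ s) {Ω : Type*}
    [MeasurableSpace Ω] {P : Measure Ω} [IsProbabilityMeasure P]
    {X X' : Ω → Matrix (Fin q) (Fin q) ℂ} (hX : HasLaw X (wishart q r a) P)
    (hX' : HasLaw X' (wishart q s a) P) (hXX' : IndepFun X X' P) :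
    P.map (fun ω => jacobiTransform (X ω) (X' ω)) =
      jacobiUnitaryEnsemble q ((s - q : ℕ) : ℝ) ((r - q : ℕ) : ℝ) := by
  obtain ⟨N, hN⟩ := exists_lintegral_wishart_pair hX hX' hXX'
  obtain ⟨K, hK⟩ := exists_lintegral_jacobiTransform hr hs (measurable_gaussianWeight q a)
  have hJ : AEMeasurable (fun ω => jacobiTransform (X ω) (X' ω)) P :=
    hX.aemeasurable.jacobiTransform hX'.aemeasurable
  have : IsProbabilityMeasure (P.map fun ω => jacobiTransform (X ω) (X' ω)) :=
    Measure.isProbabilityMeasure_map hJ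
  rw [jacobiUnitaryEnsemble_eq]
  refine eq_normalizedMeasure_of_lintegral (K := N * K) fun f hf => ?_
  have hd : Measurable fun M : Matrix (Fin q) (Fin q) ℂ =>
      detPowOnCone (r - q) M * detPowOnCone (s - q) (1 - M) :=
    (measurable_detPowOnCone _).mul
      ((measurable_detPowOnCone _).comp (measurable_id.const_sub 1))
  have h1 := hN (fun x => f (jacobiTransform x.1 x.2))
    (hf.comp (measurable_fst.jacobiTransform measurable_snd))
  rw [lintegral_map' hf.aemeasurable hJ, h1, hK f hf,
    lintegral_withDensity_eq_lintegral_mul _ hd hf, mul_assoc]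
  rfl

theorem theorem2p2 {n q r : ℕ} (hq : 0 < q) (hr : r ≤ n)
    (p : Matrix (Fin n) (Fin n) ℂ) (hp : IsStarProjection p) (hpq : p.rank = q)
    {Ω : Type*} [MeasurableSpace Ω] (P : Measure Ω) [IsProbabilityMeasure P]
    (Q : Ω → Matrix (Fin n) (Fin n) ℂ) (hQ : HasLaw Q (uniformProjection n r) P)
    {Ω' : Type*} [MeasurableSpace Ω'] (P' : Measure Ω') [IsProbabilityMeasure P']
    (X X' : Ω' → Matrix (Fin q) (Fin q) ℂ)
    (hX : HasLaw X (wishart q r (1 / (q : ℝ))) P')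
    (hX' : HasLaw X' (wishart q (n - r) (1 / (q : ℝ))) P')
    (hXX' : IndepFun X X' P') :
    (∀ᵐ ω ∂P', (X ω + X' ω).PosDef) ∧
    (∃ V : Matrix (Fin n) (Fin q) ℂ, IsCornerIsometry p V) ∧
    ∀ V : Matrix (Fin n) (Fin q) ℂ, IsCornerIsometry p V →
      IdentDistrib (fun ω => Vᴴ * (p * Q ω * p) * V)
        (fun ω => jacobiTransform (X ω) (X' ω)) P P' ∧
      (q ≤ r → q + r ≤ n →
        HasLaw (fun ω => Vᴴ * (p * Q ω * p) * V)
          (jacobiUnitaryEnsemble q ((n : ℝ) - q - r) ((r : ℝ) - q)) P) := by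
  have hqn : q ≤ n := by
    rw [← hpq]
    simpa using p.rank_le_card_width
  obtain ⟨s, rfl⟩ := Nat.exists_eq_add_of_le hr
  rw [Nat.add_sub_cancel_left] at hX'
  refine ⟨ae_posDef_add_of_wishart hqn hX hX' hXX', exists_isCornerIsometry hp hpq,
    fun V hV => ?_⟩
  have hmeas : AEMeasurable (fun ω => Vᴴ * (p * Q ω * p) * V) P := by
    have hc : Continuous fun M : Matrix (Fin (r + s)) (Fin (r + s)) ℂ => Vᴴ * (p * M * p) * V := by
      fun_prop
    exact hc.measurable.comp_aemeasurable hQ.aemeasurable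
  have hJ : AEMeasurable (fun ω => jacobiTransform (X ω) (X' ω)) P' :=
    hX.aemeasurable.jacobiTransform hX'.aemeasurable
  have hlaw : P.map (fun ω => Vᴴ * (p * Q ω * p) * V) =
      P'.map (fun ω => jacobiTransform (X ω) (X' ω)) := by
    refine Measure.ext_of_lintegral _ fun F hF => ?_
    rw [lintegral_map' hF.aemeasurable hmeas, lintegral_map' hF.aemeasurable hJ,
      lintegral_uniformProjection_corner hQ hV hF,
      lintegral_jacobiTransform_wishart hqn hX hX' hXX' hV.1 hF]
  refine ⟨⟨hmeas, hJ, hlaw⟩, fun hqr hqs => ⟨hmeas, ?_⟩⟩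
  have hqs' : q ≤ s := by omega
  rw [hlaw, map_jacobiTransform_wishart hqr hqs' hX hX' hXX', Nat.cast_sub hqr, Nat.cast_sub hqs']
  congr 1
  push_cast
  ring
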